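/- Let $P$ be a strictly convex polygon in the Euclidean plane, i.e. all its interior angles lie in $(0,\pi)$, and let $\mathcal A$ be its finite set of edges. For $p\in P$ and a direction $\theta\in S^1$, consider the forward billiard trajectory $\tau_+(p,\theta)$ in $P$ (motion along straight lines, with optical reflection in the edges). If it is nonsingular, i.e. never hits a vertex at a positive time, let ${\sf B}_+(p,\theta)=(E_1,E_2,\dots)\in\mathcal A^{\mathbb N}$ be the sequence of edges that it successively hits; if $p$ itself lies on the boundary, the sequence begins with the next edge that is hit. Let ${\sf B}_+(P)\subset\mathcal A^{\mathbb N}$ be the set of all sequences ${\sf B}_+(p,\theta)$ of nonsingular forward trajectories, and let $\overline{{\sf B}_+(P)}$ be its closure in $\mathcal A^{\mathbb N}$ for the product of the discrete topologies. An edge $A$ is a prefix for a sequence $(E_1,E_2,\dots)$ if $(A,E_1,E_2,\dots)\in\overline{{\sf B}_+(P)}$. Let $A$ and $B$ be two distinct edges of $P$. Then $A$ and $B$ are adjacent (share a vertex) if and only if $\{A,B\}$ is a set of common prefixes realizable by an aperiodic sequence, i.e. there is a sequence $(E_i)_{i\ge 1}\in{\sf B}_+(P)$ that is not periodic (there is no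 $m\ge 1$ with $E_{i+m}=E_i$ for all $i\geq 1$) such that both $A$ and $B$ are prefixes for $(E_i)$. -/

import Mathlib

noncomputable section

/-- The Euclidean plane. -/
abbrev Plane : Type := EuclideanSpace ℝ (Fin 2)

namespace BilliardTable

variable {n : ℕ}

/-- The successor `finRotate n i` of `i` in the cyclic order; the `i`-th edge of a polygon joins
the `i`-th vertex to the next one. -/
abbrev next (i : Fin n) : Fin n := finRotate n i

/-- A strictly convex polygon, with vertices listed in cyclic order (in either orientation):
there are at least three vertices, and for every edge all the other vertices lie strictly on one
and the same side of the line spanned by that edge. Equivalently, the closed polygonal line is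
simple and all its interior angles lie in `(0, π)`. -/
def IsStrictlyConvex (P : Polygon Plane n) : Prop :=
  3 ≤ n ∧ ∀ i j k : Fin n, j ≠ i → j ≠ next i → k ≠ i → k ≠ next i →
    (line[ℝ, P i, P (next i)]).SSameSide (P j) (P k)

/-- The billiard table bounded by a convex polygon: the closed region it encloses. -/
def table (P : Polygon Plane n) : Set Plane :=
  convexHull ℝ (Set.range P.vertices)

/-- The relative interior of the `i`-th edge, i.e. the edge without its two end points. -/
def openEdge (P : Polygon Plane n) (i : Fin n) : Set Plane :=
  openSegment ℝ (P i) (P (next i))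

/-- Optical reflection of a velocity in the `i`-th edge. -/
def reflect (P : Polygon Plane n) (i : Fin n) (u : Plane) : Plane :=
  (Submodule.span ℝ {P (next i) - P i}).reflection u

/-- Two edges are adjacent when they are distinct and meet in a vertex. -/
def Adjacent (P : Polygon Plane n) (A B : Fin n) : Prop :=
  A ≠ B ∧ ∃ k : Fin n, P k ∈ P.edgeSet ℝ A ∧ P k ∈ P.edgeSet ℝ B

/-- The forward billiard trajectory from the point `p` with velocity `u` is nonsingular and its
forward bounce sequence is `e`. Here `x 0 = p` and `x (k + 1)` is the `k`-th bounce point, which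
lies in the relative interior of the edge `e k` (so the trajectory never hits a vertex), and `d k`
is the velocity on the segment from `x k` to `x (k + 1)`, whose interior runs inside the table.
In particular, if `p` lies on an edge, then that edge itself is not recorded. -/
def HasForwardBounceSequence (P : Polygon Plane n) (p u : Plane) (e : ℕ → Fin n) : Prop :=
  ∃ x d : ℕ → Plane, x 0 = p ∧ d 0 = u ∧ ∀ k : ℕ,
    (∃ t : ℝ, 0 < t ∧ x (k + 1) = x k + t • d k) ∧
    openSegment ℝ (x k) (x (k + 1)) ⊆ interior (table P) ∧
    x (k + 1) ∈ openEdge P (e k) ∧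
    d (k + 1) = reflect P (e k) (d k)

/-- The forward bounce spectrum `B₊(P)`: all forward bounce sequences of nonsingular forward
trajectories, as a subset of the space of sequences of edges. -/
def forwardBounceSpectrum (P : Polygon Plane n) : Set (ℕ → Fin n) :=
  {e | ∃ p ∈ table P, ∃ u : Plane, ‖u‖ = 1 ∧ HasForwardBounceSequence P p u e}

/-- The sequence `(A, e 0, e 1, …)`. -/
def prepend (A : Fin n) (e : ℕ → Fin n) : ℕ → Fin n
  | 0 => A
  | k + 1 => e k

/-- `A` is a prefix for `e`: the sequence `(A, e 0, e 1, …)` lies in the closure of `B₊(P)`, for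
the product of the discrete topologies. -/
def IsPrefix (P : Polygon Plane n) (A : Fin n) (e : ℕ → Fin n) : Prop :=
  prepend A e ∈ closure (forwardBounceSpectrum P)

/-- A sequence is periodic if it is invariant under some positive shift. -/
def IsPeriodicSeq (e : ℕ → Fin n) : Prop :=
  ∃ m : ℕ, 0 < m ∧ Function.Periodic e m

/-- A set of edges is a realizable set of common prefixes, realized by an aperiodic sequence: all
its members are prefixes for one and the same aperiodic sequence in `B₊(P)`. -/
def IsRealizableSetOfCommonPrefixes (P : Polygon Plane n) (S : Set (Fin n)) : Prop :=
  ∃ e ∈ forwardBounceSpectrum P, ¬ IsPeriodicSeq e ∧ ∀ A ∈ S, IsPrefix P A e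

end BilliardTable

end

namespace BilliardTable

variable {n : ℕ}

/-! ### Linear algebra of the plane -/

/-! The heart of the matter is rigidity (`IsWeakTrajectory.unique`): an aperiodic code determines
its trajectory. Weak trajectories, which may pass through vertices or run along edges, form a
compact space, so every code in the closure of the spectrum has one. Two of them with the same code
have the same velocities: otherwise their transversal offset would grow with the travelled length,
which is unbounded, while the table is bounded (`velocity_unique`). If their positions differ, they
bound a strip of parallel trajectories of some width `w > 0`. An aperiodic sequence contains
arbitrarily long words preceded by two different letters, so compactness yields two codes of width
`w` that differ only in their first letter. Strips issuing from different edges in the same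
direction do not overlap, so the common tail has width `2 * w`; it is again aperiodic. Iterating,
the width exceeds the diameter of the table, which is absurd.

From prefixes to adjacency: if `A` is a prefix of an aperiodic `e`, a weak trajectory with code `(A,
e 0, e 1, …)` has, by rigidity, the actual trajectory as its tail, so the ray backwards from the
first bounce point ends on `A`. The same ray ends on `B`; by convexity its end point is unique, so
it lies on both edges and is a vertex.

From adjacency to prefixes: shoot from the common vertex in an inward direction that avoids the
countably many unfolded vertices. Were the code periodic, the trajectory would return to its first
bounce along the same line, now coming from a point inside an edge instead of the vertex. Parallel
trajectories from points of `A` or `B` close to the vertex follow the same code for a long time, and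
each extends backwards by a bounce on that edge; so both edges are prefixes. -/

theorem inner_eq_coords (a b : Plane) : inner ℝ a b = a 0 * b 0 + a 1 * b 1 := by
  simp [PiLp.inner_apply, Fin.sum_univ_two, mul_comm]

theorem sq_add_sq_of_norm_eq_one {a : Plane} (ha : ‖a‖ = 1) : a 0 ^ 2 + a 1 ^ 2 = 1 := by
  have h := real_inner_self_eq_norm_sq a
  rw [inner_eq_coords, ha] at h
  linarith

theorem Plane.ext_coords {a b : Plane} (h₀ : a 0 = b 0) (h₁ : a 1 = b 1) : a = b := by
  ext i
  fin_cases i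
  · exact h₀
  · exact h₁

/-- The signed area of the parallelogram spanned by two vectors. -/
def cross (a b : Plane) : ℝ := a 0 * b 1 - a 1 * b 0

theorem cross_self (a : Plane) : cross a a = 0 := by
  simp only [cross]; ring

theorem cross_add (a b c : Plane) : cross a (b + c) = cross a b + cross a c := by
  simp only [cross, PiLp.add_apply]; ring

theorem cross_sub (a b c : Plane) : cross a (b - c) = cross a b - cross a c := by
  simp only [cross, PiLp.sub_apply]; ring

theorem cross_smul (a b : Plane) (r : ℝ) : cross a (r • b) = r * cross a b := by
  simp only [cross, PiLp.smul_apply, smul_eq_mul]; ring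

theorem abs_cross_le (a b : Plane) : |cross a b| ≤ ‖a‖ * ‖b‖ := by
  apply abs_le_of_sq_le_sq _ (by positivity)
  rw [mul_pow, ← real_inner_self_eq_norm_sq, ← real_inner_self_eq_norm_sq, inner_eq_coords,
    inner_eq_coords, cross]
  nlinarith [sq_nonneg (a 0 * b 0 + a 1 * b 1)]

theorem continuous_cross : Continuous fun p : Plane × Plane => cross p.1 p.2 := by
  unfold cross
  fun_prop

/-- Reflection in the line orthogonal to a unit vector. -/
noncomputable def mirror (ν u : Plane) : Plane := u - (2 * inner ℝ ν u) • ν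

theorem mirror_apply (ν u : Plane) (i : Fin 2) :
    mirror ν u i = u i - 2 * (ν 0 * u 0 + ν 1 * u 1) * ν i := by
  simp [mirror, inner_eq_coords]

theorem inner_mirror {ν : Plane} (hν : ‖ν‖ = 1) (u : Plane) :
    inner ℝ ν (mirror ν u) = -inner ℝ ν u := by
  rw [mirror, inner_sub_right, inner_smul_right, real_inner_self_eq_norm_sq, hν]
  ring

theorem mirror_mirror {ν : Plane} (hν : ‖ν‖ = 1) (u : Plane) : mirror ν (mirror ν u) = u := by
  rw [mirror, inner_mirror hν, mirror]
  module

theorem norm_mirror {ν : Plane} (hν : ‖ν‖ = 1) (u : Plane) : ‖mirror ν u‖ = ‖u‖ := by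
  have h : ‖mirror ν u‖ ^ 2 = ‖u‖ ^ 2 := by
    rw [← real_inner_self_eq_norm_sq, ← real_inner_self_eq_norm_sq, inner_eq_coords,
      inner_eq_coords, mirror_apply, mirror_apply]
    linear_combination 4 * (ν 0 * u 0 + ν 1 * u 1) ^ 2 * sq_add_sq_of_norm_eq_one hν
  exact (sq_eq_sq₀ (norm_nonneg _) (norm_nonneg _)).1 h

theorem cross_mirror_mirror {ν : Plane} (hν : ‖ν‖ = 1) (u v : Plane) :
    cross (mirror ν u) (mirror ν v) = -cross u v := by
  simp only [cross, mirror_apply]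
  linear_combination (-2 * (u 0 * v 1 - u 1 * v 0)) * sq_add_sq_of_norm_eq_one hν

theorem mirror_of_inner_eq_zero {ν v : Plane} (hv : inner ℝ ν v = 0) : mirror ν v = v := by
  simp [mirror, hv]

/-- A vector orthogonal to `ν` and parallel to `d` vanishes if `d` is not orthogonal to `ν`. -/
theorem eq_zero_of_inner_eq_zero_of_cross_eq_zero {ν d v : Plane} (hd : inner ℝ ν d ≠ 0)
    (hv : inner ℝ ν v = 0) (hc : cross d v = 0) : v = 0 := by
  rw [inner_eq_coords] at hd hv
  rw [cross] at hc
  apply Plane.ext_coords <;> apply mul_left_cancel₀ hd <;> simp only [PiLp.zero_apply]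
  · linear_combination d 0 * hv - ν 1 * hc
  · linear_combination d 1 * hv + ν 0 * hc

/-- Two vectors orthogonal to a common unit vector are parallel. -/
theorem cross_eq_zero_of_inner_eq_zero {ν a b : Plane} (hν : ‖ν‖ = 1) (ha : inner ℝ ν a = 0)
    (hb : inner ℝ ν b = 0) : cross a b = 0 := by
  rw [inner_eq_coords] at ha hb
  have h := sq_add_sq_of_norm_eq_one hν
  rw [cross]
  linear_combination (-(a 0 * b 1 - a 1 * b 0)) * h + (ν 0 * b 1 - ν 1 * b 0) * ha
    - (ν 0 * a 1 - ν 1 * a 0) * hb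

/-- A vector parallel to a unit vector `d` is a multiple of it. -/
theorem eq_smul_of_cross_eq_zero {d v : Plane} (hd : ‖d‖ = 1) (h : cross d v = 0) :
    v = (inner ℝ d v) • d := by
  have hd := sq_add_sq_of_norm_eq_one hd
  rw [cross] at h
  apply Plane.ext_coords <;> simp only [PiLp.smul_apply, smul_eq_mul, inner_eq_coords]
  · linear_combination -v 0 * hd - d 1 * h
  · linear_combination -v 1 * hd + d 0 * h

/-- A vector orthogonal to the unit vector `ν` is a multiple of any nonzero such vector. -/
theorem exists_eq_smul_of_inner_eq_zero {ν a b : Plane} (hν : ‖ν‖ = 1) (ha₀ : a ≠ 0)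
    (ha : inner ℝ ν a = 0) (hb : inner ℝ ν b = 0) : ∃ r : ℝ, b = r • a := by
  have hc := cross_eq_zero_of_inner_eq_zero hν ha hb
  have hn : ‖a‖ ≠ 0 := norm_ne_zero_iff.2 ha₀
  have h1 : ‖(‖a‖⁻¹ • a)‖ = 1 := by simp [norm_smul, hn]
  have h2 : cross (‖a‖⁻¹ • a) b = 0 := by
    have : cross (‖a‖⁻¹ • a) b = ‖a‖⁻¹ * cross a b := by simp [cross]; ring
    rw [this, hc, mul_zero]
  refine ⟨_, (eq_smul_of_cross_eq_zero h1 h2).trans (smul_smul _ _ _)⟩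

/-! ### Strictly convex polygons as intersections of half-planes -/

theorem next_ne {n : ℕ} (hn : 3 ≤ n) (i : Fin n) : next i ≠ i := by
  obtain ⟨m, rfl⟩ : ∃ m, n = m + 1 := ⟨n - 1, by omega⟩
  intro h
  have h' := congrArg Fin.val h
  rw [next, coe_finRotate] at h'
  split_ifs at h' with hi
  · rw [hi, Fin.val_last] at h'; omega
  · omega

theorem next_next_ne {n : ℕ} (hn : 3 ≤ n) (i : Fin n) : next (next i) ≠ i := by
  obtain ⟨m, rfl⟩ : ∃ m, n = m + 1 := ⟨n - 1, by omega⟩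
  intro h
  have h' := congrArg Fin.val h
  simp only [next, coe_finRotate, Fin.ext_iff, Fin.val_last] at h'
  have := i.isLt
  split_ifs at h' <;> omega

theorem IsStrictlyConvex.vertex_ne {P : Polygon Plane n} (hP : IsStrictlyConvex P) (i : Fin n) :
    P i ≠ P (next i) := by
  intro h
  have h1 := (hP.2 (next i) i i (next_ne hP.1 i).symm (next_next_ne hP.1 i).symm
    (next_ne hP.1 i).symm (next_next_ne hP.1 i).symm).left_notMem
  rw [h] at h1
  exact h1 (left_mem_affineSpan_pair ℝ _ _)

/-- The family `ν` consists of the unit normals of the edges that point into the polygon. -/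
structure IsInwardNormal (P : Polygon Plane n) (ν : Fin n → Plane) : Prop where
  norm_eq : ∀ i, ‖ν i‖ = 1
  orthogonal : ∀ i, inner ℝ (ν i) (P (next i) - P i) = 0
  pos : ∀ i j, j ≠ i → j ≠ next i → 0 < inner ℝ (ν i) (P j - P i)

theorem inner_eq_zero_iff_mem_line {P : Polygon Plane n} {i : Fin n} {μ : Plane} (hμ : ‖μ‖ = 1)
    (hi : P i ≠ P (next i)) (ho : inner ℝ μ (P (next i) - P i) = 0) (z : Plane) :
    inner ℝ μ (z - P i) = 0 ↔ z ∈ line[ℝ, P i, P (next i)] := by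
  constructor
  · intro h
    obtain ⟨r, hr⟩ := exists_eq_smul_of_inner_eq_zero hμ (sub_ne_zero.2 hi.symm) ho h
    have : z = AffineMap.lineMap (P i) (P (next i)) r := by
      rw [AffineMap.lineMap_apply, vsub_eq_sub, ← hr, vadd_eq_add, sub_add_cancel]
    rw [this]
    exact AffineMap.lineMap_mem_affineSpan_pair _ _ _
  · intro h
    obtain ⟨r, rfl⟩ := mem_affineSpan_pair_iff_exists_lineMap_eq.1 h
    rw [AffineMap.lineMap_apply, vsub_eq_sub, vadd_eq_add, add_sub_cancel_right, inner_smul_right,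
      ho, mul_zero]

theorem exists_unit_normal {a : Plane} (ha : a ≠ 0) : ∃ μ : Plane, ‖μ‖ = 1 ∧ inner ℝ μ a = 0 := by
  have h0 : (!₂[-a 1, a 0] : Plane) ≠ 0 := by
    intro h
    apply ha
    have e0 := congrArg (fun v : Plane => v 0) h
    have e1 := congrArg (fun v : Plane => v 1) h
    simp at e0 e1
    exact Plane.ext_coords (by simpa using e1) (by simpa using e0)
  refine ⟨‖(!₂[-a 1, a 0] : Plane)‖⁻¹ • !₂[-a 1, a 0], ?_, ?_⟩
  · rw [norm_smul, norm_inv, norm_norm, inv_mul_cancel₀ (norm_ne_zero_iff.2 h0)]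
  · rw [real_inner_smul_left, inner_eq_coords]
    simp
    right; ring

theorem IsStrictlyConvex.exists_isInwardNormal {P : Polygon Plane n} (hP : IsStrictlyConvex P) :
    ∃ ν : Fin n → Plane, IsInwardNormal P ν := by
  have key : ∀ i, ∃ μ : Plane, ‖μ‖ = 1 ∧ inner ℝ μ (P (next i) - P i) = 0 ∧
      ∀ j, j ≠ i → j ≠ next i → 0 < inner ℝ μ (P j - P i) := by
    intro i
    obtain ⟨μ, hμ, ho⟩ := exists_unit_normal (sub_ne_zero.2 (hP.vertex_ne i).symm)
    have hline := inner_eq_zero_iff_mem_line hμ (hP.vertex_ne i) ho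
    have hsame : ∀ j k, j ≠ i → j ≠ next i → k ≠ i → k ≠ next i →
        0 < inner ℝ μ (P j - P i) → 0 < inner ℝ μ (P k - P i) := by
      intro j k hj hj' hk hk' hpos
      obtain ⟨⟨p, hp, q, hq, hr⟩, hx, hy⟩ := hP.2 i j k hj hj' hk hk'
      obtain ⟨r, s, hr0, hs0, h⟩ := hr.exists_pos
        (vsub_ne_zero.2 fun h => hx (h ▸ hp)) (vsub_ne_zero.2 fun h => hy (h ▸ hq))
      have h' := congrArg (inner ℝ μ) h
      rw [inner_smul_right, inner_smul_right, vsub_eq_sub, vsub_eq_sub,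
        ← sub_sub_sub_cancel_right (P j) p (P i), ← sub_sub_sub_cancel_right (P k) q (P i),
        inner_sub_right, inner_sub_right _ (P k - P i), (hline p).2 hp, (hline q).2 hq, sub_zero,
        sub_zero] at h'
      have : 0 < s * inner ℝ μ (P k - P i) := h' ▸ mul_pos hr0 hpos
      exact pos_of_mul_pos_right this hs0.le
    have hne : inner ℝ μ (P (next (next i)) - P i) ≠ 0 := by
      rw [Ne, hline]
      exact (hP.2 i _ _ (next_next_ne hP.1 i) (next_ne hP.1 (next i)) (next_next_ne hP.1 i)
        (next_ne hP.1 (next i))).left_notMem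
    rcases hne.lt_or_gt with hlt | hgt
    · refine ⟨-μ, by rw [norm_neg, hμ], by rw [inner_neg_left, ho, neg_zero], fun j hj hj' => ?_⟩
      rw [inner_neg_left, neg_pos]
      by_contra! hge
      have hne' : inner ℝ μ (P j - P i) ≠ 0 := by
        rw [Ne, hline]
        exact (hP.2 i _ _ hj hj' hj hj').left_notMem
      exact lt_asymm hlt (hsame j _ hj hj' (next_next_ne hP.1 i) (next_ne hP.1 (next i))
        (lt_of_le_of_ne hge hne'.symm))
    · exact ⟨μ, hμ, ho, fun j hj hj' => hsame _ j (next_next_ne hP.1 i) (next_ne hP.1 (next i))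
        hj hj' hgt⟩
  choose ν h1 h2 h3 using key
  exact ⟨ν, h1, h2, h3⟩

/-- The signed distance of `z` to the line spanned by the `i`-th edge, for the normals `ν`. -/
noncomputable def height (P : Polygon Plane n) (ν : Fin n → Plane) (i : Fin n) (z : Plane) : ℝ :=
  inner ℝ (ν i) (z - P i)

section Height

variable {P : Polygon Plane n} {ν : Fin n → Plane}

theorem height_sub (i : Fin n) (y z : Plane) :
    height P ν i y - height P ν i z = inner ℝ (ν i) (y - z) := by
  rw [height, height, ← inner_sub_right, sub_sub_sub_cancel_right]

theorem height_add (i : Fin n) (z v : Plane) :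
    height P ν i (z + v) = height P ν i z + inner ℝ (ν i) v := by
  rw [← sub_eq_iff_eq_add', height_sub, add_sub_cancel_left]

theorem height_add_smul (i : Fin n) (z v : Plane) (t : ℝ) :
    height P ν i (z + t • v) = height P ν i z + t * inner ℝ (ν i) v := by
  rw [height_add, inner_smul_right]

theorem height_convex (i : Fin n) (y z : Plane) {a b : ℝ} (hab : a + b = 1) :
    height P ν i (a • y + b • z) = a * height P ν i y + b * height P ν i z := by
  rw [height, height, height, ← inner_smul_right, ← inner_smul_right, ← inner_add_right]
  congr 1
  have : P i = a • P i + b • P i := by rw [← add_smul, hab, one_smul]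
  nth_rewrite 1 [this]
  module

theorem continuous_height (i : Fin n) : Continuous (height P ν i) := by
  unfold height
  fun_prop

theorem IsInwardNormal.height_vertex_eq_zero_iff (hν : IsInwardNormal P ν) {i j : Fin n} :
    height P ν i (P j) = 0 ↔ j = i ∨ j = next i := by
  constructor
  · intro h
    by_contra! hne
    exact (hν.pos i j hne.1 hne.2).ne' h
  · rintro (rfl | rfl)
    · simp [height]
    · exact hν.orthogonal i

theorem IsInwardNormal.height_vertex_nonneg (hν : IsInwardNormal P ν) (i j : Fin n) :
    0 ≤ height P ν i (P j) := by
  by_cases h : j = i ∨ j = next i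
  · exact (hν.height_vertex_eq_zero_iff.2 h).ge
  · push Not at h
    exact (hν.pos i j h.1 h.2).le

/-- For the converse, a functional separating `z` from the table attains its maximum over the
vertices at some vertex. All heights of `z` being nonnegative, `z` lies in the cone spanned by the
two edges at that vertex, on which the functional cannot increase. -/
theorem mem_table_iff (hP : IsStrictlyConvex P) (hν : IsInwardNormal P ν) {z : Plane} :
    z ∈ table P ↔ ∀ i, 0 ≤ height P ν i z := by
  constructor
  · intro hz i
    have hconv : Convex ℝ {z | 0 ≤ height P ν i z} := by
      intro x hx y hy a b ha hb hab
      rw [Set.mem_ofPred_eq, height_convex i x y hab]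
      exact add_nonneg (mul_nonneg ha hx) (mul_nonneg hb hy)
    have hsub : Set.range P.vertices ⊆ {z | 0 ≤ height P ν i z} := by
      rintro _ ⟨j, rfl⟩
      exact hν.height_vertex_nonneg i j
    exact convexHull_min hsub hconv hz
  · intro hz
    by_contra hnot
    obtain ⟨f, c, hf, hfz⟩ := geometric_hahn_banach_closed_point (convex_convexHull ℝ _)
      ((Set.finite_range P.vertices).isClosed_convexHull ℝ) hnot
    have : Nonempty (Fin n) := ⟨⟨0, by have := hP.1; omega⟩⟩
    obtain ⟨k, hk⟩ := Finite.exists_max fun j => f (P j)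
    obtain ⟨i, rfl⟩ : ∃ i, next i = k := (finRotate n).surjective k
    set u := P (next (next i)) - P (next i) with hu
    set w := P i - P (next i) with hw
    have hiu : 0 < inner ℝ (ν i) u := by
      rw [hu, ← height_sub (P := P), hν.height_vertex_eq_zero_iff.2 (Or.inr rfl), sub_zero]
      exact hν.pos i _ (next_next_ne hP.1 i) (next_ne hP.1 _)
    have hiw : inner ℝ (ν i) w = 0 := by
      rw [hw, ← neg_sub, inner_neg_right, hν.orthogonal, neg_zero]
    have hju : inner ℝ (ν (next i)) u = 0 := hν.orthogonal _
    have hjw : 0 < inner ℝ (ν (next i)) w :=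
      hν.pos _ _ (next_ne hP.1 i).symm (next_next_ne hP.1 i).symm
    -- Coordinates of `z - P (next i)` in the basis of the two edge vectors at the maximizing
    -- vertex, read off from the heights over these two edges.
    have hdec : z - P (next i) = (inner ℝ (ν i) (z - P (next i)) / inner ℝ (ν i) u) • u +
        (inner ℝ (ν (next i)) (z - P (next i)) / inner ℝ (ν (next i)) w) • w := by
      rw [← sub_eq_zero]
      set v := z - P (next i)
      set D := v - ((inner ℝ (ν i) v / inner ℝ (ν i) u) • u +
        (inner ℝ (ν (next i)) v / inner ℝ (ν (next i)) w) • w) with hD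
      have hDi : inner ℝ (ν i) D = 0 := by
        rw [hD, inner_sub_right, inner_add_right, inner_smul_right, inner_smul_right, hiw,
          div_mul_cancel₀ _ hiu.ne']
        ring
      have hDj : inner ℝ (ν (next i)) D = 0 := by
        rw [hD, inner_sub_right, inner_add_right, inner_smul_right, inner_smul_right, hju,
          div_mul_cancel₀ _ hjw.ne']
        ring
      exact eq_zero_of_inner_eq_zero_of_cross_eq_zero hiu.ne' hDi
        (cross_eq_zero_of_inner_eq_zero (hν.norm_eq (next i)) hju hDj)
    have hfu : f u ≤ 0 := by rw [hu, map_sub]; exact sub_nonpos.2 (hk _)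
    have hfw : f w ≤ 0 := by rw [hw, map_sub]; exact sub_nonpos.2 (hk _)
    have hzi : 0 ≤ inner ℝ (ν i) (z - P (next i)) := by
      rw [← height_sub (P := P), hν.height_vertex_eq_zero_iff.2 (Or.inr rfl), sub_zero]
      exact hz i
    have hzj : 0 ≤ inner ℝ (ν (next i)) (z - P (next i)) := hz (next i)
    have hle : f (z - P (next i)) ≤ 0 := by
      rw [hdec, map_add, map_smul, map_smul, smul_eq_mul, smul_eq_mul]
      exact add_nonpos (mul_nonpos_of_nonneg_of_nonpos (div_nonneg hzi hiu.le) hfu)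
        (mul_nonpos_of_nonneg_of_nonpos (div_nonneg hzj hjw.le) hfw)
    rw [map_sub] at hle
    linarith [hf (P (next i)) (subset_convexHull ℝ _ ⟨_, rfl⟩)]

theorem mem_interior_table_iff (hP : IsStrictlyConvex P) (hν : IsInwardNormal P ν) {z : Plane} :
    z ∈ interior (table P) ↔ ∀ i, 0 < height P ν i z := by
  constructor
  · intro hz i
    rw [mem_interior_iff_mem_nhds] at hz
    have hcont : Filter.Tendsto (fun ε : ℝ => z + ε • ν i) (nhds 0) (nhds z) := by
      have : Continuous fun ε : ℝ => z + ε • ν i := by fun_prop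
      simpa using this.tendsto 0
    obtain ⟨ε, hε, hε0⟩ :=
      ((((hcont.eventually hz)).filter_mono nhdsWithin_le_nhds).and
        (self_mem_nhdsWithin (a := (0 : ℝ)) (s := Set.Iio 0))).exists
    have h := (mem_table_iff hP hν).1 hε i
    rw [height_add_smul, real_inner_self_eq_norm_sq, hν.norm_eq] at h
    have : ε < 0 := hε0
    linarith
  · intro hz
    have hopen : IsOpen {z | ∀ i, 0 < height P ν i z} := by
      rw [Set.ofPred_forall]
      exact isOpen_iInter_of_finite fun i => isOpen_lt continuous_const (continuous_height i)
    exact interior_maximal (fun y hy => (mem_table_iff hP hν).2 fun i => (hy i).le) hopen hz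

theorem isCompact_table (P : Polygon Plane n) : IsCompact (table P) :=
  (Set.finite_range P.vertices).isCompact_convexHull ℝ

theorem mem_edge_iff (hP : IsStrictlyConvex P) (hν : IsInwardNormal P ν) {i : Fin n} {z : Plane} :
    z ∈ segment ℝ (P i) (P (next i)) ↔ z ∈ table P ∧ height P ν i z = 0 := by
  constructor
  · intro h
    refine ⟨segment_subset_convexHull (Set.mem_range_self i) (Set.mem_range_self (next i)) h, ?_⟩
    obtain ⟨a, b, ha, hb, hab, rfl⟩ := h
    rw [height_convex i _ _ hab, hν.height_vertex_eq_zero_iff.2 (Or.inl rfl),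
      hν.height_vertex_eq_zero_iff.2 (Or.inr rfl)]
    ring
  · rintro ⟨hz, h⟩
    rw [mem_table_iff hP hν] at hz
    obtain ⟨r, hr⟩ := exists_eq_smul_of_inner_eq_zero (hν.norm_eq i)
      (sub_ne_zero.2 (hP.vertex_ne i).symm) (hν.orthogonal i) h
    have hz' : z = (1 - r) • P i + r • P (next i) := by
      rw [← sub_add_cancel z (P i), hr]
      module
    have hsum : 1 - r + r = 1 := by ring
    -- The two bounds on the parameter `r` come from the heights over the neighbouring edges `next
    -- i` and `j`, each of which vanishes at exactly one end of edge `i`.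
    obtain ⟨j, hj⟩ : ∃ j, next j = i := (finRotate n).surjective i
    refine ⟨1 - r, r, ?_, ?_, hsum, hz'.symm⟩
    · have h1 := hz (next i)
      rw [hz', height_convex _ _ _ hsum, hν.height_vertex_eq_zero_iff.2 (Or.inl rfl)] at h1
      have h2 : 0 < height P ν (next i) (P i) :=
        hν.pos _ _ (next_ne hP.1 i).symm (next_next_ne hP.1 i).symm
      exact nonneg_of_mul_nonneg_left (by linarith) h2
    · have h1 := hz j
      rw [hz', height_convex _ _ _ hsum, hν.height_vertex_eq_zero_iff.2 (Or.inr hj.symm)] at h1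
      have h2 : 0 < height P ν j (P (next i)) := by
        apply hν.pos <;> rw [← hj]
        · exact next_next_ne hP.1 j
        · exact next_ne hP.1 _
      exact nonneg_of_mul_nonneg_left (by linarith) h2

theorem eq_of_mem_pair_of_next_mem_pair (hn : 3 ≤ n) {i j : Fin n} (h : i = j ∨ i = next j)
    (h' : next i = j ∨ next i = next j) : i = j := by
  rcases h with h | h
  · exact h
  · rcases h' with h' | h'
    · exact absurd (h ▸ h') (next_next_ne hn j)
    · exact (finRotate n).injective h'

theorem height_pos_of_mem_openEdge (hP : IsStrictlyConvex P) (hν : IsInwardNormal P ν)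
    {i j : Fin n} (hji : j ≠ i) {z : Plane} (hz : z ∈ openEdge P i) : 0 < height P ν j z := by
  obtain ⟨a, b, ha, hb, hab, rfl⟩ := hz
  rw [height_convex _ _ _ hab]
  have h1 := hν.height_vertex_nonneg j i
  have h2 := hν.height_vertex_nonneg j (next i)
  rcases h1.lt_or_eq with h1 | h1
  · have := mul_pos ha h1
    have := mul_nonneg hb.le h2
    linarith
  · rcases h2.lt_or_eq with h2 | h2
    · have := mul_pos hb h2
      rw [← h1]; linarith
    · exact absurd (eq_of_mem_pair_of_next_mem_pair hP.1 (hν.height_vertex_eq_zero_iff.1 h1.symm)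
        (hν.height_vertex_eq_zero_iff.1 h2.symm)).symm hji

theorem height_eq_zero_of_mem_openEdge (hP : IsStrictlyConvex P) (hν : IsInwardNormal P ν)
    {i : Fin n} {z : Plane} (hz : z ∈ openEdge P i) : height P ν i z = 0 :=
  ((mem_edge_iff hP hν).1 (openSegment_subset_segment ℝ _ _ hz)).2

theorem mem_table_of_mem_openEdge {i : Fin n} {z : Plane} (hz : z ∈ openEdge P i) :
    z ∈ table P :=
  segment_subset_convexHull (Set.mem_range_self i) (Set.mem_range_self (next i))
    (openSegment_subset_segment ℝ _ _ hz)

theorem mem_openEdge_of_height_eq_zero (hP : IsStrictlyConvex P) (hν : IsInwardNormal P ν)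
    {i : Fin n} {z : Plane} (hz : z ∈ table P) (h : height P ν i z = 0) (hne : ∀ j, z ≠ P j) :
    z ∈ openEdge P i :=
  mem_openSegment_of_ne_left_right (hne _).symm (hne _).symm ((mem_edge_iff hP hν).2 ⟨hz, h⟩)

theorem reflect_eq_mirror (hP : IsStrictlyConvex P) (hν : IsInwardNormal P ν) (i : Fin n)
    (u : Plane) : reflect P i u = mirror (ν i) u := by
  set v := P (next i) - P i with hv
  have hv0 : v ≠ 0 := sub_ne_zero.2 (hP.vertex_ne i).symm
  have h : u - (inner ℝ v u / ‖v‖ ^ 2) • v = (inner ℝ (ν i) u) • ν i := by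
    have hvn : ‖v‖ ^ 2 ≠ 0 := pow_ne_zero _ (norm_ne_zero_iff.2 hv0)
    have h1 : inner ℝ v (u - (inner ℝ v u / ‖v‖ ^ 2) • v) = 0 := by
      rw [inner_sub_right, inner_smul_right, real_inner_self_eq_norm_sq, div_mul_cancel₀ _ hvn,
        sub_self]
    have ho : inner ℝ (ν i) v = 0 := hν.orthogonal i
    have h1' : inner ℝ (‖v‖⁻¹ • v) (u - (inner ℝ v u / ‖v‖ ^ 2) • v) = 0 := by
      rw [real_inner_smul_left, h1, mul_zero]
    have h2' : inner ℝ (‖v‖⁻¹ • v) (ν i) = 0 := by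
      rw [real_inner_smul_left, real_inner_comm, ho, mul_zero]
    have h3 := cross_eq_zero_of_inner_eq_zero
      (by rw [norm_smul, norm_inv, norm_norm, inv_mul_cancel₀ (norm_ne_zero_iff.2 hv0)]) h2' h1'
    rw [eq_smul_of_cross_eq_zero (hν.norm_eq i) h3, inner_sub_right, inner_smul_right, ho,
      mul_zero, sub_zero]
  rw [reflect, Submodule.reflection_singleton_apply, ← hv, mirror, mul_smul, ← h]
  simp only [RCLike.ofReal_real_eq_id, id]
  module

theorem IsStrictlyConvex.exists_height_pos (hP : IsStrictlyConvex P) (hν : IsInwardNormal P ν) :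
    ∃ o, ∀ i, 0 < height P ν i o := by
  let i₀ : Fin n := ⟨0, by have := hP.1; omega⟩
  let m := (1 / 2 : ℝ) • P i₀ + (1 / 2 : ℝ) • P (next i₀)
  have hm : m ∈ openEdge P i₀ := ⟨1 / 2, 1 / 2, by norm_num, by norm_num, by norm_num, rfl⟩
  refine ⟨(1 / 2 : ℝ) • m + (1 / 2 : ℝ) • P (next (next i₀)), fun i => ?_⟩
  rw [height_convex _ _ _ (by norm_num)]
  have h := hν.height_vertex_nonneg i (next (next i₀))
  by_cases hi : i = i₀
  · subst hi
    have : 0 < height P ν i₀ (P (next (next i₀))) :=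
      hν.pos i₀ _ (next_next_ne hP.1 i₀) (next_ne hP.1 _)
    rw [height_eq_zero_of_mem_openEdge hP hν hm]
    linarith
  · linarith [height_pos_of_mem_openEdge hP hν hi hm]

end Height

/-! ### Weak trajectories -/

section WeakTrajectory

variable {P : Polygon Plane n} {ν : Fin n → Plane}

theorem exists_norm_sub_le (P : Polygon Plane n) :
    ∃ D : ℝ, 0 < D ∧ ∀ y ∈ table P, ∀ z ∈ table P, ‖y - z‖ ≤ D := by
  obtain ⟨D, hD⟩ := (isCompact_table P).isBounded.exists_norm_le
  refine ⟨2 * max D 1, by positivity, fun y hy z hz => (norm_sub_le _ _).trans ?_⟩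
  linarith [hD y hy, hD z hz, le_max_left D 1]

/-- Two edges with a common point and a common direction coincide. -/
theorem edge_eq_of_inner_eq_zero (hP : IsStrictlyConvex P) (hν : IsInwardNormal P ν)
    {a b : Fin n} {x v : Plane} (hv : v ≠ 0) (ha : inner ℝ (ν a) v = 0)
    (hb : inner ℝ (ν b) v = 0) (hxa : height P ν a x = 0) (hxb : height P ν b x = 0) : a = b := by
  have key : ∀ j, height P ν a (P j) = 0 → height P ν b (P j) = 0 := by
    intro j hj
    obtain ⟨r, hr⟩ := exists_eq_smul_of_inner_eq_zero (hν.norm_eq a) hv ha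
      (b := P j - x) (by rw [← height_sub (P := P), hj, hxa, sub_zero])
    rw [← add_sub_cancel x (P j), hr, height_add_smul, hb, hxb, mul_zero, add_zero]
  exact eq_of_mem_pair_of_next_mem_pair hP.1
    (hν.height_vertex_eq_zero_iff.1 (key a (hν.height_vertex_eq_zero_iff.2 (Or.inl rfl))))
    (hν.height_vertex_eq_zero_iff.1 (key (next a) (hν.height_vertex_eq_zero_iff.2 (Or.inr rfl))))

/-- A line running strictly into the polygon both from a point of the edge `a` and from a point
of the edge `b` leaves from one and the same point. -/
theorem eq_of_cross_eq_zero (hP : IsStrictlyConvex P) (hν : IsInwardNormal P ν)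
    {a b : Fin n} {z z' d : Plane} (hd : ‖d‖ = 1) (hz : z ∈ table P) (hz' : z' ∈ table P)
    (hza : height P ν a z = 0) (hzb : height P ν b z' = 0) (ha : 0 < inner ℝ (ν a) d)
    (hb : 0 < inner ℝ (ν b) d) (hc : cross d (z' - z) = 0) : z = z' := by
  have hr := eq_smul_of_cross_eq_zero hd hc
  set r := inner ℝ d (z' - z)
  have hz'' : z' = z + r • d := by rw [← hr, add_sub_cancel]
  have h1 := (mem_table_iff hP hν).1 hz' a
  rw [hz'', height_add_smul, hza, zero_add] at h1
  have h2 := (mem_table_iff hP hν).1 hz b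
  rw [hz'', height_add_smul] at hzb
  have h3 : 0 ≤ r := nonneg_of_mul_nonneg_left h1 ha
  have h4 : r = 0 := by nlinarith
  rw [hz'', h4, zero_smul, add_zero]

/-- The closure of the notion of a billiard trajectory with bounce sequence `e`: the `k`-th bounce
point `x k` lies on the closed edge `e k`, and `d k` is the velocity right after the bounce. -/
structure IsWeakTrajectory (P : Polygon Plane n) (ν : Fin n → Plane) (e : ℕ → Fin n)
    (x d : ℕ → Plane) : Prop where
  mem_table : ∀ k, x k ∈ table P
  height_eq : ∀ k, height P ν (e k) (x k) = 0
  norm_eq : ∀ k, ‖d k‖ = 1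
  outgoing : ∀ k, 0 ≤ inner ℝ (ν (e k)) (d k)
  incoming : ∀ k, inner ℝ (ν (e (k + 1))) (d k) ≤ 0
  step : ∀ k, x (k + 1) = x k + ‖x (k + 1) - x k‖ • d k
  bounce : ∀ k, d (k + 1) = mirror (ν (e (k + 1))) (d k)
  ne : ∀ k, e k ≠ e (k + 1)

namespace IsWeakTrajectory

variable {e : ℕ → Fin n} {x y d d' : ℕ → Plane}

theorem shift (h : IsWeakTrajectory P ν e x d) (m : ℕ) :
    IsWeakTrajectory P ν (fun k => e (k + m)) (fun k => x (k + m)) (fun k => d (k + m)) where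
  mem_table k := h.mem_table _
  height_eq k := h.height_eq _
  norm_eq k := h.norm_eq _
  outgoing k := h.outgoing _
  incoming k := by simpa only [add_right_comm] using h.incoming (k + m)
  step k := by simpa only [add_right_comm] using h.step (k + m)
  bounce k := by simpa only [add_right_comm] using h.bounce (k + m)
  ne k := by simpa only [add_right_comm] using h.ne (k + m)

theorem velocity_eq_mirror (hν : IsInwardNormal P ν) (h : IsWeakTrajectory P ν e x d) (k : ℕ) :
    d k = mirror (ν (e (k + 1))) (d (k + 1)) := by
  rw [h.bounce, mirror_mirror (hν.norm_eq _)]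

theorem velocity_ne_zero (h : IsWeakTrajectory P ν e x d) (k : ℕ) : d k ≠ 0 :=
  norm_ne_zero_iff.1 (by rw [h.norm_eq]; exact one_ne_zero)

/-- A velocity parallel to both edges would put `x (k + 1)` on both of their lines, so the edges
would coincide, against the field `ne`. -/
theorem abs_inner_add_abs_inner_pos (hP : IsStrictlyConvex P) (hν : IsInwardNormal P ν)
    (h : IsWeakTrajectory P ν e x d) (k : ℕ) :
    0 < |inner ℝ (ν (e k)) (d k)| + |inner ℝ (ν (e (k + 1))) (d k)| := by
  by_contra! hle
  have h1 : inner ℝ (ν (e k)) (d k) = 0 :=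
    abs_eq_zero.1 (le_antisymm (by linarith [abs_nonneg (inner ℝ (ν (e (k + 1))) (d k))])
      (abs_nonneg _))
  have h2 : inner ℝ (ν (e (k + 1))) (d k) = 0 :=
    abs_eq_zero.1 (le_antisymm (by linarith [abs_nonneg (inner ℝ (ν (e k)) (d k))])
      (abs_nonneg _))
  refine h.ne k (edge_eq_of_inner_eq_zero hP hν (h.velocity_ne_zero k) h1 h2
    (x := x (k + 1)) ?_ (h.height_eq _))
  rw [h.step, height_add_smul, h.height_eq, h1, mul_zero, zero_add]

theorem inner_sub_eq_zero (hx : IsWeakTrajectory P ν e x d) (hy : IsWeakTrajectory P ν e y d')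
    (k : ℕ) : inner ℝ (ν (e k)) (y k - x k) = 0 := by
  rw [← height_sub (P := P), hx.height_eq, hy.height_eq, sub_zero]

end IsWeakTrajectory

/-- Each field of `IsWeakTrajectory` is a closed condition on finitely many coordinates, and all
coordinates range over compact sets. Writing the step length as a norm keeps that condition closed,
at the price of allowing steps of length zero. -/
theorem isCompact_setOf_isWeakTrajectory (P : Polygon Plane n) (ν : Fin n → Plane) :
    IsCompact {q : (ℕ → Fin n) × (ℕ → Plane) × (ℕ → Plane) |
      IsWeakTrajectory P ν q.1 q.2.1 q.2.2} := by
  have hK : IsCompact ((Set.univ : Set (ℕ → Fin n)) ×ˢ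
      ((Set.univ.pi fun _ : ℕ => table P) ×ˢ
        (Set.univ.pi fun _ : ℕ => Metric.closedBall (0 : Plane) 1))) :=
    isCompact_univ.prod ((isCompact_univ_pi fun _ => isCompact_table P).prod
      (isCompact_univ_pi fun _ => isCompact_closedBall _ _))
  refine hK.of_isClosed_subset ?_ ?_
  · have hn : ∀ k, Continuous fun q : (ℕ → Fin n) × (ℕ → Plane) × (ℕ → Plane) => ν (q.1 k) :=
      fun k => (continuous_of_discreteTopology (f := ν)).comp
        ((continuous_apply k).comp continuous_fst)
    have hv : ∀ k, Continuous fun q : (ℕ → Fin n) × (ℕ → Plane) × (ℕ → Plane) => P (q.1 k) :=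
      fun k => (continuous_of_discreteTopology (f := P.vertices)).comp
        ((continuous_apply k).comp continuous_fst)
    have he : ∀ k, Continuous fun q : (ℕ → Fin n) × (ℕ → Plane) × (ℕ → Plane) => q.1 k :=
      fun k => (continuous_apply k).comp continuous_fst
    have hx : ∀ k, Continuous fun q : (ℕ → Fin n) × (ℕ → Plane) × (ℕ → Plane) => q.2.1 k :=
      fun k => (continuous_apply k).comp (continuous_fst.comp continuous_snd)
    have hd : ∀ k, Continuous fun q : (ℕ → Fin n) × (ℕ → Plane) × (ℕ → Plane) => q.2.2 k :=
      fun k => (continuous_apply k).comp (continuous_snd.comp continuous_snd)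
    have hset : {q : (ℕ → Fin n) × (ℕ → Plane) × (ℕ → Plane) |
        IsWeakTrajectory P ν q.1 q.2.1 q.2.2} = ⋂ k : ℕ,
        ({q | q.2.1 k ∈ table P} ∩ {q | inner ℝ (ν (q.1 k)) (q.2.1 k - P (q.1 k)) = 0} ∩
        {q | ‖q.2.2 k‖ = 1} ∩ {q | 0 ≤ inner ℝ (ν (q.1 k)) (q.2.2 k)} ∩
        {q | inner ℝ (ν (q.1 (k + 1))) (q.2.2 k) ≤ 0} ∩
        {q | q.2.1 (k + 1) = q.2.1 k + ‖q.2.1 (k + 1) - q.2.1 k‖ • q.2.2 k} ∩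
        {q | q.2.2 (k + 1) = q.2.2 k -
          (2 * inner ℝ (ν (q.1 (k + 1))) (q.2.2 k)) • ν (q.1 (k + 1))} ∩
        {q | q.1 k ≠ q.1 (k + 1)}) := by
      ext q
      simp only [Set.mem_iInter, Set.mem_inter_iff, Set.mem_ofPred_eq]
      constructor
      · intro h k
        exact ⟨⟨⟨⟨⟨⟨⟨h.1 k, h.2 k⟩, h.3 k⟩, h.4 k⟩, h.5 k⟩, h.6 k⟩, h.7 k⟩, h.8 k⟩
      · intro h
        exact ⟨fun k => (h k).1.1.1.1.1.1.1, fun k => (h k).1.1.1.1.1.1.2,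
          fun k => (h k).1.1.1.1.1.2, fun k => (h k).1.1.1.1.2, fun k => (h k).1.1.1.2,
          fun k => (h k).1.1.2, fun k => (h k).1.2, fun k => (h k).2⟩
    rw [hset]
    refine isClosed_iInter fun k => ?_
    have hn0 := hn k
    have hn1 := hn (k + 1)
    have hv0 := hv k
    have hx0 := hx k
    have hx1 := hx (k + 1)
    have hd0 := hd k
    have hd1 := hd (k + 1)
    have hi : Continuous fun q : (ℕ → Fin n) × (ℕ → Plane) × (ℕ → Plane) =>
      inner ℝ (ν (q.1 (k + 1))) (q.2.2 k) := hn1.inner hd0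
    refine ((((((IsClosed.inter (IsClosed.inter ?_ ?_) ?_).inter ?_).inter ?_).inter ?_).inter
      ?_).inter ?_)
    · exact (isCompact_table P).isClosed.preimage hx0
    · exact isClosed_eq (hn0.inner (hx0.sub hv0)) continuous_const
    · exact isClosed_eq hd0.norm continuous_const
    · exact isClosed_le continuous_const (hn0.inner hd0)
    · exact isClosed_le hi continuous_const
    · exact isClosed_eq hx1 (hx0.add ((hx1.sub hx0).norm.smul hd0))
    · exact isClosed_eq hd1 (hd0.sub ((continuous_const.mul hi).smul hn1))
    · have hclopen : IsClosed {p : Fin n × Fin n | p.1 ≠ p.2} := isClosed_discrete _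
      exact hclopen.preimage ((he k).prodMk (he (k + 1)))
  · rintro q hq
    exact ⟨trivial, fun k _ => hq.mem_table k, fun k _ => by
      rw [mem_closedBall_zero_iff, hq.norm_eq]⟩

/-- Every sequence in the closure of the codes of weak trajectories is such a code. -/
theorem isClosed_setOf_exists_isWeakTrajectory (P : Polygon Plane n) (ν : Fin n → Plane) :
    IsClosed {e | ∃ x d, IsWeakTrajectory P ν e x d} := by
  convert ((isCompact_setOf_isWeakTrajectory P ν).image continuous_fst).isClosed using 1
  ext e
  constructor
  · rintro ⟨x, d, h⟩
    exact ⟨(e, x, d), h, rfl⟩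
  · rintro ⟨⟨e, x, d⟩, h, rfl⟩
    exact ⟨x, d, h⟩

/-- Shift invariance reduces to the first step, where a positive continuous function attains its
minimum on a compact space. Of any two consecutive bounces, one is therefore uniformly far from
grazing. -/
theorem exists_le_abs_inner_add_abs_inner (hP : IsStrictlyConvex P) (hν : IsInwardNormal P ν) :
    ∃ c : ℝ, 0 < c ∧ ∀ e x d, IsWeakTrajectory P ν e x d → ∀ k,
      c ≤ |inner ℝ (ν (e k)) (d k)| + |inner ℝ (ν (e (k + 1))) (d k)| := by
  have hcont : Continuous fun q : (ℕ → Fin n) × (ℕ → Plane) × (ℕ → Plane) =>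
      |inner ℝ (ν (q.1 0)) (q.2.2 0)| + |inner ℝ (ν (q.1 1)) (q.2.2 0)| := by
    have hn : ∀ k, Continuous fun q : (ℕ → Fin n) × (ℕ → Plane) × (ℕ → Plane) => ν (q.1 k) :=
      fun k => (continuous_of_discreteTopology (f := ν)).comp
        ((continuous_apply k).comp continuous_fst)
    have hd : Continuous fun q : (ℕ → Fin n) × (ℕ → Plane) × (ℕ → Plane) => q.2.2 0 :=
      (continuous_apply 0).comp (continuous_snd.comp continuous_snd)
    exact ((hn 0).inner hd).abs.add ((hn 1).inner hd).abs
  rcases Set.eq_empty_or_nonempty {q : (ℕ → Fin n) × (ℕ → Plane) × (ℕ → Plane) |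
      IsWeakTrajectory P ν q.1 q.2.1 q.2.2} with hemp | hne
  · refine ⟨1, one_pos, fun e x d h => ?_⟩
    have : (e, x, d) ∈ {q : (ℕ → Fin n) × (ℕ → Plane) × (ℕ → Plane) |
      IsWeakTrajectory P ν q.1 q.2.1 q.2.2} := h
    rw [hemp] at this
    exact this.elim
  · obtain ⟨q, hq, hmin⟩ :=
      (isCompact_setOf_isWeakTrajectory P ν).exists_isMinOn hne hcont.continuousOn
    refine ⟨_, IsWeakTrajectory.abs_inner_add_abs_inner_pos hP hν hq 0, fun e x d h k => ?_⟩
    have hk := isMinOn_iff.1 hmin (_, _, _) (h.shift k)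
    simpa [add_comm] using hk

/-! ### Infinite length of weak trajectories -/

namespace IsWeakTrajectory

variable {e : ℕ → Fin n} {x y d d' : ℕ → Plane}

/-- A weak trajectory has infinite length. -/
theorem exists_lt_sum_length (hP : IsStrictlyConvex P) (hν : IsInwardNormal P ν)
    (h : IsWeakTrajectory P ν e x d) (M : ℝ) :
    ∃ N, M < ∑ k ∈ Finset.range N, ‖x (k + 1) - x k‖ := by
  obtain ⟨D, -, hD⟩ := exists_norm_sub_le P
  obtain ⟨c, hc, hcle⟩ := exists_le_abs_inner_add_abs_inner hP hν
  obtain ⟨o, ho⟩ := hP.exists_height_pos hν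
  have hot : o ∈ table P := (mem_table_iff hP hν).2 fun i => (ho i).le
  have : Nonempty (Fin n) := ⟨e 0⟩
  obtain ⟨i₀, hi₀⟩ := Finite.exists_min fun i => height P ν i o
  set δ := height P ν i₀ o with hδ
  have hδ0 : 0 < δ := ho i₀
  -- `G` is bounded. Along a segment it grows by the length of the segment; at a bounce it drops by
  -- twice the normal speed times the distance from `o` to the edge line, which is at least `δ`. So
  -- every bounce that is not nearly grazing has to be paid for with length.
  set G : ℕ → ℝ := fun k => inner ℝ (d k) (x k - o) with hG
  have hGle : ∀ k, |G k| ≤ D := by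
    intro k
    refine (abs_real_inner_le_norm _ _).trans ?_
    rw [h.norm_eq, one_mul]
    exact hD _ (h.mem_table k) _ hot
  have hstep : ∀ k, G (k + 1) - G k + 2 * δ * |inner ℝ (ν (e (k + 1))) (d k)| ≤
      ‖x (k + 1) - x k‖ := by
    intro k
    have e1 : inner ℝ (d k) (x (k + 1) - o) = G k + ‖x (k + 1) - x k‖ := by
      have : x (k + 1) - o = (x k - o) + ‖x (k + 1) - x k‖ • d k := by
        nth_rewrite 1 [h.step k]; module
      rw [this, inner_add_right, inner_smul_right, real_inner_self_eq_norm_sq, h.norm_eq]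
      simp [hG]
    have e2 : G (k + 1) = G k + ‖x (k + 1) - x k‖ +
        2 * inner ℝ (ν (e (k + 1))) (d k) * height P ν (e (k + 1)) o := by
      have e3 : inner ℝ (ν (e (k + 1))) (x (k + 1) - o) = -height P ν (e (k + 1)) o := by
        rw [← height_sub (P := P), h.height_eq, zero_sub]
      simp only [hG]
      rw [h.bounce, mirror, inner_sub_left, e1, real_inner_smul_left, e3]
      simp only [hG]; ring
    have e4 := h.incoming k
    rw [e2, abs_of_nonpos e4]
    nlinarith [hi₀ (e (k + 1))]
  -- Bounces are taken in pairs, because only the sum of two consecutive normal speeds is bounded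
  -- below by `c`.
  have htwo : ∀ N : ℕ, G (2 * N) - G 0 + 2 * δ * c * N ≤
      ∑ k ∈ Finset.range (2 * N), ‖x (k + 1) - x k‖ := by
    intro N
    induction N with
    | zero => simp
    | succ N ih =>
      rw [show 2 * (N + 1) = 2 * N + 1 + 1 by ring, Finset.sum_range_succ, Finset.sum_range_succ]
      have h1 := hstep (2 * N)
      have h2 := hstep (2 * N + 1)
      have h3 := hcle e x d h (2 * N + 1)
      have h4 : |inner ℝ (ν (e (2 * N + 1))) (d (2 * N + 1))| =
          |inner ℝ (ν (e (2 * N + 1))) (d (2 * N))| := by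
        rw [h.bounce, inner_mirror (hν.norm_eq _), abs_neg]
      rw [h4] at h3
      push_cast
      nlinarith
  obtain ⟨N, hN⟩ := exists_nat_gt ((M + 2 * D) / (2 * δ * c))
  refine ⟨2 * N, lt_of_lt_of_le ?_ (htwo N)⟩
  rw [div_lt_iff₀ (by positivity)] at hN
  have h1 := (abs_le.1 (hGle (2 * N))).1
  have h2 := (abs_le.1 (hGle 0)).2
  linarith

end IsWeakTrajectory

/-- The difference of two bounce points on the same edge is fixed by the reflection, which reverses
orientation. So at a bounce the transversal offset changes sign, after having drifted along the
segment by `t'` times the cross product of the velocities. -/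
theorem cross_mirror_sub {ν₀ x y x₁ y₁ d d' : Plane} {t t' : ℝ} (hν₀ : ‖ν₀‖ = 1)
    (hx : x₁ = x + t • d) (hy : y₁ = y + t' • d') (h : inner ℝ ν₀ (y₁ - x₁) = 0) :
    cross (mirror ν₀ d) (y₁ - x₁) = -(cross d (y - x) + t' * cross d d') := by
  rw [← mirror_of_inner_eq_zero h, cross_mirror_mirror hν₀, hx, hy,
    show y + t' • d' - (x + t • d) = (y - x) + t' • d' - t • d by module, cross_sub, cross_add,
    cross_smul, cross_smul, cross_self]
  ring

/-! ### Weak trajectories with a common code -/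

namespace IsWeakTrajectory

variable {e : ℕ → Fin n} {x y d d' : ℕ → Plane}

theorem cross_velocity_succ (hν : IsInwardNormal P ν) (hx : IsWeakTrajectory P ν e x d)
    (hy : IsWeakTrajectory P ν e y d') (k : ℕ) :
    cross (d (k + 1)) (d' (k + 1)) = -cross (d k) (d' k) := by
  rw [hx.bounce, hy.bounce, cross_mirror_mirror (hν.norm_eq _)]

/-- The code of a weak trajectory determines its velocities. -/
theorem velocity_unique (hP : IsStrictlyConvex P) (hν : IsInwardNormal P ν)
    (hx : IsWeakTrajectory P ν e x d) (hy : IsWeakTrajectory P ν e y d') : d' = d := by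
  obtain ⟨D, hD0, hD⟩ := exists_norm_sub_le P
  have hc : ∀ k, cross (d k) (d' k) = (-1) ^ k * cross (d 0) (d' 0) := by
    intro k
    induction k with
    | zero => simp
    | succ k ih => rw [hx.cross_velocity_succ hν hy, ih]; ring
  have hs : ∀ k, cross (d k) (y k - x k) = (-1) ^ k * (cross (d 0) (y 0 - x 0) +
      (∑ j ∈ Finset.range k, ‖y (j + 1) - y j‖) * cross (d 0) (d' 0)) := by
    intro k
    induction k with
    | zero => simp
    | succ k ih =>
      rw [hx.bounce, cross_mirror_sub (hν.norm_eq _) (hx.step k) (hy.step k)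
        (hx.inner_sub_eq_zero hy (k + 1)), ih, hc k, Finset.sum_range_succ]
      ring
  have hb : ∀ k, |cross (d k) (y k - x k)| ≤ D := fun k => by
    refine (abs_cross_le _ _).trans ?_
    rw [hx.norm_eq, one_mul]
    exact hD _ (hy.mem_table k) _ (hx.mem_table k)
  -- Otherwise the offset `hs`, affine in the travelled length up to sign, would exceed the bound
  -- `D`.
  have hzero : cross (d 0) (d' 0) = 0 := by
    by_contra hne
    obtain ⟨N, hN⟩ := hy.exists_lt_sum_length hP hν (2 * D / |cross (d 0) (d' 0)|)
    rw [div_lt_iff₀ (abs_pos.2 hne)] at hN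
    have h1 := hb N
    have h0 := hb 0
    rw [hs, abs_mul, abs_pow, abs_neg, abs_one, one_pow, one_mul] at h1
    set T := ∑ k ∈ Finset.range N, ‖y (k + 1) - y k‖
    have hT : 0 ≤ T := Finset.sum_nonneg fun _ _ => norm_nonneg _
    have h2 : T * |cross (d 0) (d' 0)| = |T * cross (d 0) (d' 0)| := by
      rw [abs_mul, abs_of_nonneg hT]
    have h3 := abs_sub_abs_le_abs_sub (T * cross (d 0) (d' 0)) (-cross (d 0) (y 0 - x 0))
    rw [abs_neg, sub_neg_eq_add, add_comm (T * cross (d 0) (d' 0))] at h3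
    linarith
  funext k
  have hr := eq_smul_of_cross_eq_zero (hx.norm_eq k) (by rw [hc k, hzero, mul_zero])
  set r := inner ℝ (d k) (d' k)
  have habs : |r| = 1 := by
    have := hy.norm_eq k
    rwa [hr, norm_smul, hx.norm_eq, mul_one, Real.norm_eq_abs] at this
  rcases eq_or_eq_neg_of_abs_eq habs with h1 | h1
  · rw [hr, h1, one_smul]
  -- Opposite velocities would both have to leave edge `e k` and approach edge `e (k + 1)`, so both
  -- normal speeds would vanish.
  · rw [h1, neg_one_smul] at hr
    exfalso
    have h2 := hy.outgoing k
    have h3 := hy.incoming k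
    rw [hr, inner_neg_right] at h2 h3
    have h4 := hx.outgoing k
    have h5 := hx.incoming k
    have h6 := hx.abs_inner_add_abs_inner_pos hP hν k
    rw [abs_of_nonneg h4, abs_of_nonpos h5] at h6
    linarith

theorem cross_succ (hν : IsInwardNormal P ν) (hx : IsWeakTrajectory P ν e x d)
    (hy : IsWeakTrajectory P ν e y d) (k : ℕ) :
    cross (d (k + 1)) (y (k + 1) - x (k + 1)) = -cross (d k) (y k - x k) := by
  rw [hx.bounce, cross_mirror_sub (hν.norm_eq _) (hx.step k) (hy.step k)
    (hx.inner_sub_eq_zero hy (k + 1)), cross_self, mul_zero, add_zero]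

theorem cross_eq (hν : IsInwardNormal P ν) (hx : IsWeakTrajectory P ν e x d)
    (hy : IsWeakTrajectory P ν e y d) (k : ℕ) :
    cross (d k) (y k - x k) = (-1) ^ k * cross (d 0) (y 0 - x 0) := by
  induction k with
  | zero => simp
  | succ k ih => rw [hx.cross_succ hν hy, ih]; ring

theorem eq_of_cross_eq_zero (hx : IsWeakTrajectory P ν e x d)
    (hy : IsWeakTrajectory P ν e y d) {k : ℕ} (hd : inner ℝ (ν (e k)) (d k) ≠ 0)
    (hc : cross (d k) (y k - x k) = 0) : y k = x k :=
  sub_eq_zero.1 (eq_zero_of_inner_eq_zero_of_cross_eq_zero hd (hx.inner_sub_eq_zero hy k) hc)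

/-- A velocity tangent to the edge would be parallel to `y k - x k`, which lies along that edge. -/
theorem inner_pos_of_cross_ne_zero (hν : IsInwardNormal P ν) (hx : IsWeakTrajectory P ν e x d)
    (hy : IsWeakTrajectory P ν e y d) {k : ℕ} (hc : cross (d k) (y k - x k) ≠ 0) :
    0 < inner ℝ (ν (e k)) (d k) :=
  lt_of_le_of_ne (hx.outgoing k) fun h => hc <|
    cross_eq_zero_of_inner_eq_zero (hν.norm_eq _) h.symm (hx.inner_sub_eq_zero hy k)

theorem velocity_periodic (hP : IsStrictlyConvex P) (hν : IsInwardNormal P ν)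
    (hx : IsWeakTrajectory P ν e x d) {m : ℕ} (hm : Function.Periodic e m) (k : ℕ) :
    d (k + m) = d k := by
  have h := hx.shift m
  rw [show (fun k => e (k + m)) = e from funext hm] at h
  exact congrFun (hx.velocity_unique hP hν h) k

/-- A transversal weak trajectory with periodic code is periodic. -/
theorem position_periodic (hP : IsStrictlyConvex P) (hν : IsInwardNormal P ν)
    (hx : IsWeakTrajectory P ν e x d) {m : ℕ} (hm : Function.Periodic e m)
    (hd : inner ℝ (ν (e 0)) (d 0) ≠ 0) : x (2 * m) = x 0 := by
  obtain ⟨D, hD0, hD⟩ := exists_norm_sub_le P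
  have hper : ∀ i : ℕ, IsWeakTrajectory P ν e (fun k => x (k + i * m)) d := by
    intro i
    have h := hx.shift (i * m)
    have hi : Function.Periodic e (i * m) := by
      simpa using hm.nsmul i
    rwa [show (fun k => e (k + i * m)) = e from funext hi,
      show (fun k => d (k + i * m)) = d from funext (hx.velocity_periodic hP hν hi)] at h
  set s := cross (d 0) (x (2 * m) - x 0) with hs
  -- Shifting by `2 * m`, an even number of reflections, preserves the sign of offsets. The
  -- displacements of successive returns therefore add up, and boundedness of the table forces `s =
  -- 0`.
  have hsum : ∀ i : ℕ, cross (d 0) (x (2 * i * m) - x 0) = i * s := by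
    intro i
    induction i with
    | zero => simp [cross]
    | succ i ih =>
      have h1 := (hper 0).cross_eq hν (hper 2) (2 * i * m)
      have h2 : d (2 * i * m) = d 0 := by
        have := hx.velocity_periodic hP hν (m := 2 * i * m) (by simpa using hm.nsmul (2 * i)) 0
        rwa [zero_add] at this
      rw [h2, mul_assoc 2 i m, pow_mul, neg_one_sq, one_pow, one_mul, zero_add, zero_mul, add_zero,
        add_zero, ← mul_assoc] at h1
      have h3 : x (2 * (i + 1) * m) - x 0 =
          (x (2 * i * m + 2 * m) - x (2 * i * m)) + (x (2 * i * m) - x 0) := by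
        rw [show 2 * (i + 1) * m = 2 * i * m + 2 * m by ring]; abel
      rw [h3, cross_add, h1, ih]
      push_cast
      ring
  have hs0 : s = 0 := by
    by_contra hne
    obtain ⟨N, hN⟩ := exists_nat_gt (D / |s|)
    rw [div_lt_iff₀ (abs_pos.2 hne)] at hN
    have h1 := abs_cross_le (d 0) (x (2 * N * m) - x 0)
    rw [hsum, hx.norm_eq, one_mul, abs_mul, Nat.abs_cast] at h1
    linarith [hD _ (hx.mem_table (2 * N * m)) _ (hx.mem_table 0)]
  have := hx.eq_of_cross_eq_zero (hper 2) (k := 0) hd (by rw [zero_add]; exact hs0)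
  rwa [zero_add] at this

end IsWeakTrajectory

end WeakTrajectory

/-! ### Rigidity of aperiodic codes -/

/-- In a sequence over a finite alphabet that is not periodic, there are arbitrarily long words
that occur after two different letters. -/
theorem exists_left_special {α : Type*} [Finite α] {e : ℕ → α}
    (he : ∀ m, 0 < m → ¬ Function.Periodic e m) (N : ℕ) :
    ∃ k l, e k ≠ e l ∧ ∀ j < N, e (k + 1 + j) = e (l + 1 + j) := by
  by_contra! hno
  have hback : ∀ k l, e k ≠ e l → ¬ ∀ j < N, e (k + 1 + j) = e (l + 1 + j) := by
    intro k l h1 h2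
    obtain ⟨j, hj, h⟩ := hno k l h1
    exact h (h2 j hj)
  -- If words of length `N` determine the letter before them, a coincidence of two such words
  -- propagates backwards.
  have hdown : ∀ i k m, (∀ j < N, e (k + i + j) = e (k + i + m + j)) →
      ∀ j < i + N, e (k + j) = e (k + m + j) := by
    intro i
    induction i with
    | zero =>
      intro k m h j hj
      exact h j (by omega)
    | succ i ih =>
      intro k m h
      have h1 : ∀ j < i + N, e (k + 1 + j) = e (k + 1 + m + j) := by
        apply ih
        intro j hj
        have := h j hj
        rwa [show k + 1 + i = k + (i + 1) by ring]
      have h2 : e k = e (k + m) := by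
        by_contra hne
        refine hback _ _ hne fun j hj => ?_
        rw [h1 j (by omega), add_right_comm k 1 m]
      intro j hj
      rcases j with _ | j
      · exact h2
      · have := h1 j (by omega)
        rwa [show k + (j + 1) = k + 1 + j by ring, show k + m + (j + 1) = k + 1 + m + j by ring]
  -- By pigeonhole, two equal words beyond position `M` make the initial word periodic, with a
  -- period bounded independently of `M`.
  have hword : ∀ M, ∃ m ≤ Nat.card (Fin N → α), 0 < m ∧ ∀ i ≤ M, e i = e (i + m) := by
    intro M
    have := Fintype.ofFinite α
    classical
    obtain ⟨a, b, hab, heq⟩ := Fintype.exists_ne_map_eq_of_card_lt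
      (fun (a : Fin (Nat.card (Fin N → α) + 1)) (j : Fin N) => e (M + a + 1 + j))
      (by rw [Nat.card_eq_fintype_card, Fintype.card_fin]; exact Nat.lt_succ_self _)
    wlog hlt : a < b generalizing a b
    · exact this b a hab.symm heq.symm (lt_of_le_of_ne (not_lt.1 hlt) hab.symm)
    have hlt' : (a : ℕ) < b := hlt
    refine ⟨b - a, by omega, by omega, fun i hi => ?_⟩
    have h := hdown (M + a + 1) 0 (b - a) (fun j hj => ?_) i (by omega)
    · rw [zero_add, zero_add, add_comm (_ - _)] at h
      exact h
    · have h := congrFun heq ⟨j, hj⟩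
      simp only at h
      rw [zero_add, show M + a + 1 + (b - a) + j = M + b + 1 + j by omega]
      exact h
  have hbad : ∀ m, ∃ i, 0 < m → e i ≠ e (i + m) := by
    intro m
    by_contra! hm
    exact he m (hm 0).1 fun i => (hm i).2.symm
  -- Only finitely many periods are possible, so a single `M` past a failure of each of them gives
  -- the contradiction.
  choose f hf using hbad
  obtain ⟨m, hm, hm0, h⟩ :=
    hword ((Finset.range (Nat.card (Fin N → α) + 1)).sup f)
  exact hf m hm0 (h _ (Finset.le_sup (f := f) (Finset.mem_range.2 (by omega))))

/-! ### Strips of parallel trajectories and the doubling of their width -/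

section Width

variable {P : Polygon Plane n} {ν : Fin n → Plane}

/-- There is a strip of width at least `w` of parallel weak trajectories with code `e`. -/
def HasWidth (P : Polygon Plane n) (ν : Fin n → Plane) (w : ℝ) (e : ℕ → Fin n) : Prop :=
  ∃ x y d, IsWeakTrajectory P ν e x d ∧ IsWeakTrajectory P ν e y d ∧ w ≤ cross (d 0) (y 0 - x 0)

/-- A reflection reverses orientation, so the two boundary trajectories exchange their roles. -/
theorem HasWidth.shift_one (hν : IsInwardNormal P ν) {w : ℝ} {e : ℕ → Fin n}
    (h : HasWidth P ν w e) : HasWidth P ν w fun k => e (k + 1) := by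
  obtain ⟨x, y, d, hx, hy, hw⟩ := h
  refine ⟨_, _, _, hy.shift 1, hx.shift 1, hw.trans (le_of_eq ?_)⟩
  rw [hy.cross_succ hν hx 0, ← neg_sub (x 0), ← neg_one_smul ℝ (x 0 - y 0), cross_smul]
  ring

theorem HasWidth.shift (hν : IsInwardNormal P ν) {w : ℝ} {e : ℕ → Fin n}
    (h : HasWidth P ν w e) (m : ℕ) : HasWidth P ν w fun k => e (k + m) := by
  induction m with
  | zero => exact h
  | succ m ih =>
    have := ih.shift_one hν
    simpa only [add_right_comm _ 1 m, add_assoc] using this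

theorem isClosed_setOf_hasWidth (P : Polygon Plane n) (ν : Fin n → Plane) (w : ℝ) :
    IsClosed {e | HasWidth P ν w e} := by
  have hK := isCompact_setOf_isWeakTrajectory P ν
  have hC : IsClosed {q : ((ℕ → Fin n) × (ℕ → Plane) × (ℕ → Plane)) ×
      ((ℕ → Fin n) × (ℕ → Plane) × (ℕ → Plane)) |
      (q.1.1 = q.2.1 ∧ q.1.2.2 = q.2.2.2) ∧ w ≤ cross (q.1.2.2 0) (q.2.2.1 0 - q.1.2.1 0)} := by
    have hle : IsClosed {q : ((ℕ → Fin n) × (ℕ → Plane) × (ℕ → Plane)) ×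
        ((ℕ → Fin n) × (ℕ → Plane) × (ℕ → Plane)) |
        w ≤ cross (q.1.2.2 0) (q.2.2.1 0 - q.1.2.1 0)} :=
      isClosed_le continuous_const (continuous_cross.comp
        (f := fun q : ((ℕ → Fin n) × (ℕ → Plane) × (ℕ → Plane)) ×
          ((ℕ → Fin n) × (ℕ → Plane) × (ℕ → Plane)) => (q.1.2.2 0, q.2.2.1 0 - q.1.2.1 0))
        (by fun_prop))
    exact (IsClosed.inter (isClosed_eq (by fun_prop) (by fun_prop))
      (isClosed_eq (by fun_prop) (by fun_prop))).inter hle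
  convert (((hK.prod hK).inter_right hC).image (continuous_fst.comp continuous_fst)).isClosed
    using 1
  ext e
  constructor
  · rintro ⟨x, y, d, hx, hy, hw⟩
    exact ⟨((e, x, d), (e, y, d)), ⟨⟨hx, hy⟩, ⟨rfl, rfl⟩, hw⟩, rfl⟩
  · rintro ⟨⟨⟨e, x, d⟩, ⟨e', y, d'⟩⟩, ⟨⟨hx, hy⟩, ⟨h1, h2⟩, hw⟩, rfl⟩
    dsimp only at h1 h2
    subst h1 h2
    exact ⟨x, y, d, hx, hy, hw⟩

/-- Left special words of length `N` give pairs of shifts of `e` that differ at the first letter and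
agree on the next `N`. The sets `Z N` of such pairs are nested, nonempty and compact, so they have a
common element. -/
theorem exists_hasWidth_pair (hν : IsInwardNormal P ν) {w : ℝ} {e : ℕ → Fin n}
    (h : HasWidth P ν w e) (he : ∀ m, 0 < m → ¬ Function.Periodic e m) :
    ∃ g g', HasWidth P ν w g ∧ HasWidth P ν w g' ∧ g 0 ≠ g' 0 ∧ ∀ k, g (k + 1) = g' (k + 1) := by
  let Z : ℕ → Set ((ℕ → Fin n) × (ℕ → Fin n)) := fun N =>
    {q | HasWidth P ν w q.1} ∩ {q | HasWidth P ν w q.2} ∩ {q | q.1 0 ≠ q.2 0} ∩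
      {q | ∀ j < N, q.1 (j + 1) = q.2 (j + 1)}
  have hclosed : ∀ N, IsClosed (Z N) := by
    intro N
    refine (((((isClosed_setOf_hasWidth P ν w).preimage continuous_fst).inter
      ((isClosed_setOf_hasWidth P ν w).preimage continuous_snd)).inter ?_).inter ?_)
    · have hd : IsClosed {p : Fin n × Fin n | p.1 ≠ p.2} := isClosed_discrete _
      exact hd.preimage (f := fun q : (ℕ → Fin n) × (ℕ → Fin n) => (q.1 0, q.2 0)) (by fun_prop)
    · simp only [Set.ofPred_forall]
      exact isClosed_iInter fun j => isClosed_iInter fun _ =>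
        isClosed_eq (by fun_prop) (by fun_prop)
  obtain ⟨⟨g, g'⟩, hq⟩ := IsCompact.nonempty_iInter_of_sequence_nonempty_isCompact_isClosed Z
    (fun N q hq => ⟨hq.1, fun j hj => hq.2 j (by omega)⟩) (fun N => by
      obtain ⟨k, l, hkl, hj⟩ := exists_left_special he N
      refine ⟨(_, _), ⟨⟨h.shift hν k, h.shift hν l⟩, ?_⟩, fun j hjN => ?_⟩
      · simpa using hkl
      · have := hj j hjN
        simpa only [add_comm, add_left_comm] using this) (hclosed 0).isCompact hclosed
  rw [Set.mem_iInter] at hq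
  exact ⟨g, g', (hq 0).1.1.1, (hq 0).1.1.2, (hq 0).1.2, fun k => (hq (k + 1)).2 k (by omega)⟩

/-- A strip whose code is periodic from the first bounce on has a purely periodic code. -/
theorem eq_of_periodic_tail (hP : IsStrictlyConvex P) (hν : IsInwardNormal P ν) {w : ℝ}
    (hw : 0 < w) {g : ℕ → Fin n} (h : HasWidth P ν w g) {m : ℕ}
    (hm : Function.Periodic (fun k => g (k + 1)) m) : g (2 * m) = g 0 := by
  obtain ⟨x, y, d, hx, hy, hxy⟩ := h
  have hc0 : 0 < cross (d 0) (y 0 - x 0) := hw.trans_le hxy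
  have hck : ∀ k, cross (d k) (y k - x k) ≠ 0 := fun k => by
    rw [hx.cross_eq hν hy]
    exact mul_ne_zero (pow_ne_zero _ (by norm_num)) hc0.ne'
  have hin : ∀ k, 0 < inner ℝ (ν (g k)) (d k) := fun k =>
    hx.inner_pos_of_cross_ne_zero hν hy (hck k)
  have hd1 : d (2 * m + 1) = d 1 := by
    have h1 := (hx.shift 1).velocity_periodic hP hν hm
    rw [two_mul, add_assoc, ← h1 0, ← h1 (0 + m)]
    congr 1; ring
  have hg1 : g (2 * m + 1) = g (0 + 1) := by
    have h1 := hm 0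
    have h2 := hm m
    simp only [zero_add] at h1 h2 ⊢
    rw [two_mul, h2, h1]
  have hd : d (2 * m) = d 0 := by
    rw [hx.velocity_eq_mirror hν (2 * m), hd1, hg1, ← hx.velocity_eq_mirror hν 0]
  have hpos : ∀ z, IsWeakTrajectory P ν g z d → cross (d 0) (z (2 * m) - z 0) = 0 := by
    intro z hz
    have h1 := (hz.shift 1).position_periodic hP hν hm (hin 1).ne'
    have h2 := hz.step (2 * m)
    have h3 := hz.step 0
    simp only [zero_add] at h1 h3
    rw [h1, hd] at h2
    obtain ⟨r, hr⟩ : ∃ r : ℝ, z 1 = z (2 * m) + r • d 0 := ⟨_, h2⟩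
    obtain ⟨s, hs⟩ : ∃ s : ℝ, z 1 = z 0 + s • d 0 := ⟨_, h3⟩
    have h4 : z (2 * m) - z 0 = (s - r) • d 0 := by
      linear_combination (norm := module) hr.symm.trans hs
    rw [h4, cross_smul, cross_self, mul_zero]
  by_contra hne
  -- The midpoint lies on edge `g 0`, and tracing back from its common next bounce it also lies on
  -- edge `g (2 * m)`. Heights being nonnegative on the table, both ends of the strip then lie on
  -- that second edge too, and two edges sharing two distinct points coincide.
  have hmid : ∀ k, (1 / 2 : ℝ) • x k + (1 / 2 : ℝ) • y k ∈ table P ∧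
      height P ν (g k) ((1 / 2 : ℝ) • x k + (1 / 2 : ℝ) • y k) = 0 := fun k =>
    ⟨convex_convexHull ℝ _ (hx.mem_table k) (hy.mem_table k) (by norm_num) (by norm_num)
      (by norm_num), by
        rw [height_convex _ _ _ (by norm_num), hx.height_eq, hy.height_eq]; norm_num⟩
  have heq := eq_of_cross_eq_zero hP hν (hx.norm_eq 0) (hmid 0).1 (hmid (2 * m)).1 (hmid 0).2
    (hmid (2 * m)).2 (hin 0) (hd ▸ hin (2 * m)) (by
      rw [show (1 / 2 : ℝ) • x (2 * m) + (1 / 2 : ℝ) • y (2 * m) -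
        ((1 / 2 : ℝ) • x 0 + (1 / 2 : ℝ) • y 0) = (1 / 2 : ℝ) • (x (2 * m) - x 0) +
        (1 / 2 : ℝ) • (y (2 * m) - y 0) by module, cross_add, cross_smul, cross_smul, hpos x hx,
        hpos y hy]
      norm_num)
  have hz := (hmid (2 * m)).2
  rw [← heq, height_convex _ _ _ (by norm_num)] at hz
  have h1 := (mem_table_iff hP hν).1 (hx.mem_table 0) (g (2 * m))
  have h2 := (mem_table_iff hP hν).1 (hy.mem_table 0) (g (2 * m))
  have h3 : height P ν (g (2 * m)) (x 0) = 0 := by linarith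
  have h4 : height P ν (g (2 * m)) (y 0) = 0 := by linarith
  have hv : y 0 - x 0 ≠ 0 := by
    intro h0
    rw [h0] at hc0
    simp [cross] at hc0
  exact hne (edge_eq_of_inner_eq_zero hP hν hv (by rw [← height_sub (P := P), h3, h4, sub_zero])
    (hx.inner_sub_eq_zero hy 0) h3 (hx.height_eq 0))

/-- Two strips issuing in the same direction from different edges do not overlap. -/
theorem strips_disjoint (hP : IsStrictlyConvex P) (hν : IsInwardNormal P ν) {a b : Fin n}
    (hab : a ≠ b) {x y x' y' d : Plane} (hd : ‖d‖ = 1) (hx : x ∈ table P) (hy : y ∈ table P)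
    (hx' : x' ∈ table P) (hy' : y' ∈ table P) (hxa : height P ν a x = 0)
    (hya : height P ν a y = 0) (hxb : height P ν b x' = 0) (hyb : height P ν b y' = 0)
    (hda : 0 < inner ℝ (ν a) d) (hdb : 0 < inner ℝ (ν b) d) (hlt : cross d x < cross d y)
    (hlt' : cross d x' < cross d y') : cross d y ≤ cross d x' ∨ cross d y' ≤ cross d x := by
  by_contra! hno
  -- If the strips overlapped, some offset `c` would lie strictly inside both. The line at that
  -- offset would start from one and the same point of both edges, interior to each base segment,
  -- which forces the edges to coincide.
  obtain ⟨c, hc1, hc2⟩ : ∃ c, max (cross d x) (cross d x') < c ∧ c < min (cross d y) (cross d y') :=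
    exists_between (max_lt (lt_min hlt hno.2) (lt_min hno.1 hlt'))
  rw [max_lt_iff] at hc1
  rw [lt_min_iff] at hc2
  have key : ∀ p q : Plane, cross d p < c → c < cross d q →
      ∃ s t : ℝ, 0 < s ∧ 0 < t ∧ s + t = 1 ∧ cross d (s • p + t • q) = c := by
    intro p q hp hq
    have hpq : 0 < cross d q - cross d p := by linarith
    refine ⟨(cross d q - c) / (cross d q - cross d p), (c - cross d p) / (cross d q - cross d p),
      div_pos (by linarith) hpq, div_pos (by linarith) hpq, ?_, ?_⟩
    · rw [← add_div]
      rw [div_eq_one_iff_eq hpq.ne']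
      ring
    · rw [cross_add, cross_smul, cross_smul]
      field_simp
      ring
  obtain ⟨s, t, hs, ht, hst, hz⟩ := key x y hc1.1 hc2.1
  obtain ⟨s', t', hs', ht', hst', hz'⟩ := key x' y' hc1.2 hc2.2
  have heq := eq_of_cross_eq_zero hP hν hd
    (convex_convexHull ℝ _ hx hy hs.le ht.le hst) (convex_convexHull ℝ _ hx' hy' hs'.le ht'.le hst')
    (by rw [height_convex _ _ _ hst, hxa, hya]; ring)
    (by rw [height_convex _ _ _ hst', hxb, hyb]; ring) hda hdb (by rw [cross_sub, hz, hz', sub_self])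
  have hb0 : height P ν b (s • x + t • y) = 0 := by
    rw [heq, height_convex _ _ _ hst', hxb, hyb]; ring
  rw [height_convex _ _ _ hst] at hb0
  have h1 := (mem_table_iff hP hν).1 hx b
  have h2 := (mem_table_iff hP hν).1 hy b
  have h3 : height P ν b x = 0 := by
    have := mul_nonneg hs.le h1
    have := mul_nonneg ht.le h2
    have h5 : s * height P ν b x = 0 := by linarith
    exact (mul_eq_zero.1 h5).resolve_left hs.ne'
  have h4 : height P ν b y = 0 := by
    rw [h3, mul_zero, zero_add] at hb0
    exact (mul_eq_zero.1 hb0).resolve_left ht.ne'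
  have hv : y - x ≠ 0 := fun h => by rw [sub_eq_zero.1 h] at hlt; exact lt_irrefl _ hlt
  exact hab (edge_eq_of_inner_eq_zero hP hν hv (by rw [← height_sub (P := P), hxa, hya, sub_zero])
    (by rw [← height_sub (P := P), h3, h4, sub_zero]) hxa h3)

/-- The two disjoint strips merge at their common next bounce, and the outermost trajectories bound
a strip for the tail. If the tail were periodic, `eq_of_periodic_tail` would recover both distinct
first letters as the same letter of the tail. -/
theorem exists_hasWidth_two_mul (hP : IsStrictlyConvex P) (hν : IsInwardNormal P ν) {w : ℝ}
    (hw : 0 < w) {e : ℕ → Fin n} (h : HasWidth P ν w e)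
    (he : ∀ m, 0 < m → ¬ Function.Periodic e m) :
    ∃ f, HasWidth P ν (2 * w) f ∧ ∀ m, 0 < m → ¬ Function.Periodic f m := by
  obtain ⟨g, g', hg, hg', hne, htail⟩ := exists_hasWidth_pair hν h he
  have htail' : (fun k => g (k + 1)) = fun k => g' (k + 1) := funext htail
  refine ⟨fun k => g (k + 1), ?_, fun m hm0 hm => hne ?_⟩
  · obtain ⟨x, y, d, hx, hy, hxy⟩ := hg
    obtain ⟨x', y', d', hx', hy', hxy'⟩ := hg'
    have hxs := hx.shift 1
    have hys := hy.shift 1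
    have hxs' := hx'.shift 1
    have hys' := hy'.shift 1
    rw [← htail'] at hxs' hys'
    have hdd := hxs.velocity_unique hP hν hxs'
    have hd1 : d' 1 = d 1 := congrFun hdd 0
    have hd0 : d' 0 = d 0 := by
      rw [hx.velocity_eq_mirror hν, hx'.velocity_eq_mirror hν, ← htail 0]
      exact congrArg _ hd1
    rw [hdd] at hxs' hys'
    rw [hd0] at hxy'
    have hin : 0 < inner ℝ (ν (g 0)) (d 0) :=
      hx.inner_pos_of_cross_ne_zero hν hy (hw.trans_le hxy).ne'
    have hin' : 0 < inner ℝ (ν (g' 0)) (d 0) := by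
      rw [← hd0]
      exact hx'.inner_pos_of_cross_ne_zero hν hy' (by rw [hd0]; exact (hw.trans_le hxy').ne')
    -- Offsets after the common bounce are the offsets before it, with reversed sign; this compares
    -- trajectories from different initial edges.
    have hcross : ∀ (a b : ℕ → Fin n) (p q d₁ d₂ : ℕ → Plane), IsWeakTrajectory P ν a p d₁ →
        IsWeakTrajectory P ν b q d₂ → d₁ 0 = d 0 → d₂ 0 = d 0 → a 1 = g 1 → b 1 = g 1 →
        cross (d 1) (q 1 - p 1) = cross (d 0) (p 0) - cross (d 0) (q 0) := by
      intro a b p q d₁ d₂ hp hq h1 h2 h3 h4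
      have h5 := hp.step 0
      have h6 := hq.step 0
      rw [h1] at h5
      rw [h2] at h6
      have h7 : inner ℝ (ν (g 1)) (q 1 - p 1) = 0 := by
        have hp1 := hp.height_eq 1
        have hq1 := hq.height_eq 1
        rw [h3] at hp1
        rw [h4] at hq1
        rw [← height_sub (P := P), hp1, hq1, sub_zero]
      have h8 := cross_mirror_sub (hν.norm_eq (g 1)) h5 h6 h7
      rw [← hx.bounce 0, cross_self, mul_zero, add_zero, cross_sub (d 0)] at h8
      exact h8.trans (neg_sub _ _)
    have hg1 : g' 1 = g 1 := (htail 0).symm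
    rw [cross_sub] at hxy hxy'
    rcases strips_disjoint hP hν hne (hx.norm_eq 0) (hx.mem_table 0) (hy.mem_table 0)
      (hx'.mem_table 0) (hy'.mem_table 0) (hx.height_eq 0) (hy.height_eq 0) (hx'.height_eq 0)
      (hy'.height_eq 0) hin hin' (by linarith) (by linarith) with hc | hc
    · refine ⟨_, _, _, hys', hxs, ?_⟩
      have := hcross _ _ _ _ _ _ hy' hx hd0 rfl hg1 rfl
      simp only [zero_add]
      linarith
    · refine ⟨_, _, _, hys, hxs', ?_⟩
      have := hcross _ _ _ _ _ _ hy hx' rfl hd0 rfl hg1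
      simp only [zero_add]
      linarith
  · have h1 := eq_of_periodic_tail hP hν hw hg hm
    have h2 := eq_of_periodic_tail hP hν hw hg' (htail' ▸ hm)
    rw [← h1, ← h2]
    obtain ⟨j, hj⟩ : ∃ j, 2 * m = j + 1 := ⟨2 * m - 1, by omega⟩
    rw [hj]
    exact htail j

/-- A code that is not periodic does not admit a strip of trajectories. -/
theorem not_hasWidth_of_not_periodic (hP : IsStrictlyConvex P) (hν : IsInwardNormal P ν) {w : ℝ}
    (hw : 0 < w) {e : ℕ → Fin n} (he : ∀ m, 0 < m → ¬ Function.Periodic e m) :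
    ¬ HasWidth P ν w e := by
  intro h
  have hpow : ∀ N : ℕ, ∃ f, HasWidth P ν (2 ^ N * w) f ∧
      ∀ m, 0 < m → ¬ Function.Periodic f m := by
    intro N
    induction N with
    | zero => exact ⟨e, by simpa using h, he⟩
    | succ N ih =>
      obtain ⟨f, hf, hf'⟩ := ih
      rw [pow_succ', mul_assoc]
      exact exists_hasWidth_two_mul hP hν (by positivity) hf hf'
  obtain ⟨D, -, hD⟩ := exists_norm_sub_le P
  obtain ⟨N, hN⟩ := pow_unbounded_of_one_lt (D / w) (one_lt_two : (1 : ℝ) < 2)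
  rw [div_lt_iff₀ hw] at hN
  obtain ⟨f, ⟨x, y, d, hx, hy, hxy⟩, -⟩ := hpow N
  have h1 := (le_abs_self _).trans (abs_cross_le (d 0) (y 0 - x 0))
  rw [hx.norm_eq, one_mul] at h1
  linarith [hD _ (hy.mem_table 0) _ (hx.mem_table 0)]

/-- A code that is not periodic determines its trajectory, if this is transversal. -/
theorem IsWeakTrajectory.unique (hP : IsStrictlyConvex P) (hν : IsInwardNormal P ν)
    {e : ℕ → Fin n} (he : ¬ IsPeriodicSeq e) {x y d d' : ℕ → Plane}
    (hx : IsWeakTrajectory P ν e x d) (hy : IsWeakTrajectory P ν e y d')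
    (hd : inner ℝ (ν (e 0)) (d 0) ≠ 0) : y 0 = x 0 ∧ d' 0 = d 0 := by
  have hdd := hx.velocity_unique hP hν hy
  subst hdd
  have he' : ∀ m, 0 < m → ¬ Function.Periodic e m := fun m h0 hm => he ⟨m, h0, hm⟩
  refine ⟨hx.eq_of_cross_eq_zero hy hd ?_, rfl⟩
  rcases lt_trichotomy (cross (d' 0) (y 0 - x 0)) 0 with hlt | h0 | hgt
  · refine absurd ⟨y, x, d', hy, hx, le_refl _⟩
      (not_hasWidth_of_not_periodic hP hν (w := cross (d' 0) (x 0 - y 0)) ?_ he')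
    rw [cross_sub] at hlt ⊢
    linarith
  · exact h0
  · exact absurd ⟨x, y, d', hx, hy, le_refl _⟩ (not_hasWidth_of_not_periodic hP hν hgt he')

end Width

/-! ### Billiard trajectories -/

section Path

variable {P : Polygon Plane n} {ν : Fin n → Plane}

/-- The points `x` and the velocities `d` form a nonsingular billiard trajectory with bounce
sequence `e`. -/
def IsBilliardPath (P : Polygon Plane n) (e : ℕ → Fin n) (x d : ℕ → Plane) : Prop :=
  ∀ k : ℕ, (∃ t : ℝ, 0 < t ∧ x (k + 1) = x k + t • d k) ∧
    openSegment ℝ (x k) (x (k + 1)) ⊆ interior (table P) ∧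
    x (k + 1) ∈ openEdge P (e k) ∧
    d (k + 1) = reflect P (e k) (d k)

theorem exists_ne_height_vertex_eq_zero (hP : IsStrictlyConvex P) (hν : IsInwardNormal P ν)
    (i j : Fin n) : ∃ a, a ≠ i ∧ height P ν a (P j) = 0 := by
  by_cases h : j = i
  · obtain ⟨a, rfl⟩ : ∃ a, next a = j := (finRotate n).surjective j
    exact ⟨a, fun ha => next_ne hP.1 a (h.trans ha.symm),
      hν.height_vertex_eq_zero_iff.2 (Or.inr rfl)⟩
  · exact ⟨j, h, hν.height_vertex_eq_zero_iff.2 (Or.inl rfl)⟩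

theorem vertex_notMem_openEdge (hP : IsStrictlyConvex P) (hν : IsInwardNormal P ν) (i j : Fin n) :
    P j ∉ openEdge P i := by
  intro h
  obtain ⟨a, ha, h0⟩ := exists_ne_height_vertex_eq_zero hP hν i j
  exact (height_pos_of_mem_openEdge hP hν ha h).ne' h0

namespace IsBilliardPath

variable {e : ℕ → Fin n} {x d : ℕ → Plane}

theorem norm_eq (hP : IsStrictlyConvex P) (hν : IsInwardNormal P ν) (h : IsBilliardPath P e x d)
    (hd : ‖d 0‖ = 1) (k : ℕ) : ‖d k‖ = 1 := by
  induction k with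
  | zero => exact hd
  | succ k ih => rw [(h k).2.2.2, reflect_eq_mirror hP hν, norm_mirror (hν.norm_eq _), ih]

theorem bounce (hP : IsStrictlyConvex P) (hν : IsInwardNormal P ν) (h : IsBilliardPath P e x d)
    (k : ℕ) : d (k + 1) = mirror (ν (e k)) (d k) := by
  rw [(h k).2.2.2, reflect_eq_mirror hP hν]

theorem incoming_neg (hP : IsStrictlyConvex P) (hν : IsInwardNormal P ν)
    (h : IsBilliardPath P e x d) (k : ℕ) : inner ℝ (ν (e k)) (d k) < 0 := by
  obtain ⟨⟨t, ht, hx⟩, hint, hedge, -⟩ := h k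
  have hm : (1 / 2 : ℝ) • x k + (1 / 2 : ℝ) • x (k + 1) ∈ interior (table P) :=
    hint ⟨1 / 2, 1 / 2, by norm_num, by norm_num, by norm_num, rfl⟩
  have h1 := (mem_interior_table_iff hP hν).1 hm (e k)
  rw [height_convex _ _ _ (by norm_num), height_eq_zero_of_mem_openEdge hP hν hedge] at h1
  have h2 := height_eq_zero_of_mem_openEdge hP hν hedge
  rw [hx, height_add_smul] at h2
  by_contra! hge
  have := mul_nonneg ht.le hge
  linarith

theorem outgoing_pos (hP : IsStrictlyConvex P) (hν : IsInwardNormal P ν)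
    (h : IsBilliardPath P e x d) (k : ℕ) : 0 < inner ℝ (ν (e k)) (d (k + 1)) := by
  rw [h.bounce hP hν, inner_mirror (hν.norm_eq _), neg_pos]
  exact h.incoming_neg hP hν k

theorem isWeakTrajectory (hP : IsStrictlyConvex P) (hν : IsInwardNormal P ν)
    (h : IsBilliardPath P e x d) (hd : ‖d 0‖ = 1) :
    IsWeakTrajectory P ν e (fun k => x (k + 1)) (fun k => d (k + 1)) where
  mem_table k := mem_table_of_mem_openEdge (h k).2.2.1
  height_eq k := height_eq_zero_of_mem_openEdge hP hν (h k).2.2.1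
  norm_eq k := h.norm_eq hP hν hd _
  outgoing k := (h.outgoing_pos hP hν k).le
  incoming k := (h.incoming_neg hP hν (k + 1)).le
  step k := by
    obtain ⟨t, ht, hx⟩ := (h (k + 1)).1
    have : ‖x (k + 1 + 1) - x (k + 1)‖ = t := by
      rw [hx, add_sub_cancel_left, norm_smul, h.norm_eq hP hν hd, mul_one, Real.norm_eq_abs,
        abs_of_pos ht]
    rw [this, hx]
  bounce k := h.bounce hP hν (k + 1)
  ne k heq := by
    have h1 := h.outgoing_pos hP hν k
    have h2 := h.incoming_neg hP hν (k + 1)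
    rw [heq] at h1
    exact lt_asymm h1 h2

end IsBilliardPath

/-! ### From common prefixes to adjacency -/

theorem closure_forwardBounceSpectrum_subset (hP : IsStrictlyConvex P)
    (hν : IsInwardNormal P ν) :
    closure (forwardBounceSpectrum P) ⊆ {e | ∃ x d, IsWeakTrajectory P ν e x d} := by
  refine closure_minimal ?_ (isClosed_setOf_exists_isWeakTrajectory P ν)
  rintro e ⟨p, -, u, hu, x, d, rfl, rfl, h⟩
  exact ⟨_, _, IsBilliardPath.isWeakTrajectory hP hν h hu⟩

/-- A prefix of an aperiodic bounce sequence is an edge at which the backward extension of its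
trajectory ends. -/
theorem exists_backward_point_of_isPrefix (hP : IsStrictlyConvex P) (hν : IsInwardNormal P ν)
    {e : ℕ → Fin n} {x d : ℕ → Plane} (h : IsBilliardPath P e x d) (hd : ‖d 0‖ = 1)
    (he : ¬ IsPeriodicSeq e) {A : Fin n} (hA : IsPrefix P A e) :
    ∃ (y : Plane) (t : ℝ), y ∈ table P ∧ height P ν A y = 0 ∧ 0 < inner ℝ (ν A) (d 0) ∧
      x 1 = y + t • d 0 := by
  obtain ⟨y, f, hy⟩ := closure_forwardBounceSpectrum_subset hP hν hA
  have htail : IsWeakTrajectory P ν e (fun k => y (k + 1)) (fun k => f (k + 1)) := hy.shift 1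
  obtain ⟨h1, h2⟩ := (h.isWeakTrajectory hP hν hd).unique hP hν he htail
    (h.outgoing_pos hP hν 0).ne'
  have hf0 : f 0 = d 0 := by
    rw [hy.velocity_eq_mirror hν 0, h2, h.bounce hP hν 0]
    exact mirror_mirror (hν.norm_eq _) _
  have hstep := hy.step 0
  rw [h1, hf0] at hstep
  refine ⟨y 0, _, hy.mem_table 0, hy.height_eq 0, ?_, hstep⟩
  -- The first bounce point lies inside another edge, hence strictly off the line of `A`; so the
  -- velocity leaves `A` transversally.
  have hA0 : A ≠ e 0 := hy.ne 0
  have hpos := height_pos_of_mem_openEdge hP hν hA0 (h 0).2.2.1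
  have h3 : height P ν A (y 0) = 0 := hy.height_eq 0
  rw [hstep, height_add_smul, h3, zero_add] at hpos
  exact pos_of_mul_pos_right hpos (norm_nonneg _)

theorem adjacent_of_isRealizableSetOfCommonPrefixes (hP : IsStrictlyConvex P) {A B : Fin n}
    (hAB : A ≠ B) (h : IsRealizableSetOfCommonPrefixes P {A, B}) : Adjacent P A B := by
  obtain ⟨ν, hν⟩ := hP.exists_isInwardNormal
  obtain ⟨e, ⟨p, -, u, hu, x, d, -, rfl, hpath⟩, he, hpre⟩ := h
  have hpath : IsBilliardPath P e x d := hpath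
  obtain ⟨y, t, hy, hyA, hdA, hxy⟩ :=
    exists_backward_point_of_isPrefix hP hν hpath hu he (hpre A (by simp))
  obtain ⟨z, s, hz, hzB, hdB, hxz⟩ :=
    exists_backward_point_of_isPrefix hP hν hpath hu he (hpre B (by simp))
  have hyz : y = z := by
    refine eq_of_cross_eq_zero hP hν hu hy hz hyA hzB hdA hdB ?_
    have : z - y = (t - s) • d 0 := by
      linear_combination (norm := module) -(hxy.symm.trans hxz)
    rw [this, cross_smul, cross_self, mul_zero]
  subst hyz
  have hvert : ∃ k, y = P k := by
    by_contra! hne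
    exact (height_pos_of_mem_openEdge hP hν hAB.symm
      (mem_openEdge_of_height_eq_zero hP hν hy hyA hne)).ne' hzB
  obtain ⟨k, rfl⟩ := hvert
  refine ⟨hAB, k, ?_, ?_⟩ <;> rw [Polygon.edgeSet, affineSegment_eq_segment]
  · exact (mem_edge_iff hP hν).2 ⟨hy, hyA⟩
  · exact (mem_edge_iff hP hν).2 ⟨hy, hzB⟩

end Path

/-! ### Trajectories from a vertex -/

section Vertex

variable {P : Polygon Plane n} {ν : Fin n → Plane}

/-- The velocity `d` at the point `x` of the table points into the interior. -/
def PointsInward (P : Polygon Plane n) (ν : Fin n → Plane) (x d : Plane) : Prop :=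
  ∀ i, 0 < height P ν i x ∨ (height P ν i x = 0 ∧ 0 < inner ℝ (ν i) d)

/-- Reflection of a point in the line spanned by the `i`-th edge. -/
noncomputable def flip (P : Polygon Plane n) (ν : Fin n → Plane) (i : Fin n) (z : Plane) : Plane :=
  z - (2 * height P ν i z) • ν i

/-- The images of the vertices under compositions of reflections in the edges. -/
def unfoldedVertices (P : Polygon Plane n) (ν : Fin n → Plane) : Set Plane :=
  Set.range fun p : List (Fin n) × Fin n => p.1.foldr (flip P ν) (P p.2)

/-- The ray from `x` in direction `d` avoids all unfolded vertices. -/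
def AvoidsVertices (P : Polygon Plane n) (ν : Fin n → Plane) (x d : Plane) : Prop :=
  ∀ t : ℝ, 0 < t → x + t • d ∉ unfoldedVertices P ν

theorem vertex_mem_unfoldedVertices (i : Fin n) : P i ∈ unfoldedVertices P ν :=
  ⟨([], i), rfl⟩

theorem flip_mem_unfoldedVertices (i : Fin n) {z : Plane} (hz : z ∈ unfoldedVertices P ν) :
    flip P ν i z ∈ unfoldedVertices P ν := by
  obtain ⟨⟨l, j⟩, rfl⟩ := hz
  exact ⟨(i :: l, j), rfl⟩

/-- Unfolding: reflecting the ray after a bounce straightens it into the continuation of the ray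
before. This makes `AvoidsVertices` persist along the whole trajectory. -/
theorem flip_add_smul_mirror (hν : IsInwardNormal P ν) {i : Fin n} {z : Plane}
    (hz : height P ν i z = 0) (d : Plane) (t : ℝ) :
    flip P ν i (z + t • mirror (ν i) d) = z + t • d := by
  rw [flip, height_add_smul, hz, inner_mirror (hν.norm_eq i), mirror]
  module

theorem PointsInward.mem_table (hP : IsStrictlyConvex P) (hν : IsInwardNormal P ν) {x d : Plane}
    (h : PointsInward P ν x d) : x ∈ table P :=
  (mem_table_iff hP hν).2 fun i => (h i).elim le_of_lt fun h => h.1.ge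

theorem PointsInward.exists_inner_neg (hP : IsStrictlyConvex P) (hν : IsInwardNormal P ν)
    {x d : Plane} (h : PointsInward P ν x d) (hd : ‖d‖ = 1) : ∃ i, inner ℝ (ν i) d < 0 := by
  by_contra! hno
  obtain ⟨D, hD0, hD⟩ := exists_norm_sub_le P
  have hx := h.mem_table hP hν
  have hmem : x + (D + 1) • d ∈ table P := (mem_table_iff hP hν).2 fun i => by
    rw [height_add_smul]
    have := (mem_table_iff hP hν).1 hx i
    have := mul_nonneg (by linarith : 0 ≤ D + 1) (hno i)
    linarith
  have := hD _ hmem _ hx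
  rw [add_sub_cancel_left, norm_smul, hd, mul_one, Real.norm_eq_abs] at this
  linarith [le_abs_self (D + 1)]

theorem PointsInward.exists_step (hP : IsStrictlyConvex P) (hν : IsInwardNormal P ν)
    {x d : Plane} (h : PointsInward P ν x d) (hd : ‖d‖ = 1) (ha : AvoidsVertices P ν x d) :
    ∃ (i : Fin n) (t : ℝ), 0 < t ∧ openSegment ℝ x (x + t • d) ⊆ interior (table P) ∧
      x + t • d ∈ openEdge P i ∧ PointsInward P ν (x + t • d) (reflect P i d) ∧
      ‖reflect P i d‖ = 1 ∧ AvoidsVertices P ν (x + t • d) (reflect P i d) := by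
  classical
  have hne : (Finset.univ.filter fun i => inner ℝ (ν i) d < 0).Nonempty := by
    obtain ⟨i, hi⟩ := h.exists_inner_neg hP hν hd
    exact ⟨i, by simpa using hi⟩
  -- The next edge minimizes the arrival time, height divided by approach speed, among the edges
  -- being approached.
  obtain ⟨i, hi, hmin⟩ := Finset.exists_min_image _
    (fun i => height P ν i x / -inner ℝ (ν i) d) hne
  rw [Finset.mem_filter] at hi
  have hid : inner ℝ (ν i) d < 0 := hi.2
  have hix : 0 < height P ν i x := (h i).elim id fun h => absurd h.2 (not_lt.2 hid.le)
  set t := height P ν i x / -inner ℝ (ν i) d with ht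
  have ht0 : 0 < t := div_pos hix (neg_pos.2 hid)
  have hbefore : ∀ s, 0 < s → s < t → ∀ j, 0 < height P ν j (x + s • d) := by
    intro s hs hst j
    rw [height_add_smul]
    rcases lt_or_ge (inner ℝ (ν j) d) 0 with hj | hj
    · have h1 := hmin j (by simpa using hj)
      have h2 := hst.trans_le h1
      rw [lt_div_iff₀ (neg_pos.2 hj)] at h2
      linarith
    · have h1 := mul_nonneg hs.le hj
      rcases h j with h2 | ⟨h2, h3⟩
      · linarith
      · have := mul_pos hs h3
        linarith
  have hend : ∀ j, 0 ≤ height P ν j (x + t • d) := by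
    intro j
    rw [height_add_smul]
    have h0 := (mem_table_iff hP hν).1 (h.mem_table hP hν) j
    rcases lt_or_ge (inner ℝ (ν j) d) 0 with hj | hj
    · have h1 := hmin j (by simpa using hj)
      rw [le_div_iff₀ (neg_pos.2 hj)] at h1
      linarith
    · have h1 := mul_nonneg ht0.le hj
      linarith
  have hendi : height P ν i (x + t • d) = 0 := by
    rw [height_add_smul, ht, div_mul_eq_mul_div, div_neg, mul_div_cancel_right₀ _ hid.ne,
      add_neg_cancel]
  have hedge : x + t • d ∈ openEdge P i :=
    mem_openEdge_of_height_eq_zero hP hν ((mem_table_iff hP hν).2 hend) hendi fun j hj =>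
      ha t ht0 (hj ▸ vertex_mem_unfoldedVertices j)
  refine ⟨i, t, ht0, ?_, hedge, ?_⟩
  · rintro _ ⟨a, b, ha, hb, hab, rfl⟩
    rw [mem_interior_table_iff hP hν,
      show a • x + b • (x + t • d) = (a + b) • x + (b * t) • d by module, hab, one_smul]
    exact hbefore _ (mul_pos hb ht0) (by nlinarith)
  rw [reflect_eq_mirror hP hν]
  refine ⟨?_, ?_, ?_⟩
  · intro j
    by_cases hj : j = i
    · subst hj
      right
      rw [inner_mirror (hν.norm_eq _)]
      exact ⟨hendi, neg_pos.2 hid⟩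
    · exact Or.inl (height_pos_of_mem_openEdge hP hν hj hedge)
  · rw [norm_mirror (hν.norm_eq _), hd]
  · intro s hs hmem
    have h1 := flip_mem_unfoldedVertices i hmem
    rw [flip_add_smul_mirror hν hendi, add_assoc, ← add_smul] at h1
    exact ha _ (add_pos ht0 hs) h1

theorem PointsInward.exists_isBilliardPath (hP : IsStrictlyConvex P) (hν : IsInwardNormal P ν)
    {p u : Plane} (h : PointsInward P ν p u) (hu : ‖u‖ = 1) (ha : AvoidsVertices P ν p u) :
    ∃ e x d, x 0 = p ∧ d 0 = u ∧ IsBilliardPath P e x d := by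
  let S := {q : Plane × Plane // PointsInward P ν q.1 q.2 ∧ ‖q.2‖ = 1 ∧ AvoidsVertices P ν q.1 q.2}
  have hstep : ∀ q : S, ∃ (i : Fin n) (q' : S), (∃ t : ℝ, 0 < t ∧ q'.1.1 = q.1.1 + t • q.1.2) ∧
      openSegment ℝ q.1.1 q'.1.1 ⊆ interior (table P) ∧ q'.1.1 ∈ openEdge P i ∧
      q'.1.2 = reflect P i q.1.2 := by
    rintro ⟨⟨x, d⟩, h1, h2, h3⟩
    obtain ⟨i, t, ht, h4, h5, h6, h7, h8⟩ := h1.exists_step hP hν h2 h3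
    exact ⟨i, ⟨(_, _), h6, h7, h8⟩, ⟨t, ht, rfl⟩, h4, h5, rfl⟩
  choose i q' hq' using hstep
  let s : ℕ → S := fun k => q'^[k] ⟨(p, u), h, hu, ha⟩
  have hs : ∀ k, s (k + 1) = q' (s k) := fun k => Function.iterate_succ_apply' _ _ _
  refine ⟨fun k => i (s k), fun k => (s k).1.1, fun k => (s k).1.2, rfl, rfl, fun k => ?_⟩
  dsimp only
  rw [hs]
  exact hq' (s k)

theorem countable_unfoldedVertices (P : Polygon Plane n) (ν : Fin n → Plane) :
    (unfoldedVertices P ν).Countable := Set.countable_range _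

/-- Among uncountably many disjoint rays there is one that avoids all unfolded vertices. -/
theorem exists_avoidsVertices (P : Polygon Plane n) (ν : Fin n → Plane) {δ : ℝ} (hδ : 0 < δ)
    (x d : ℝ → Plane) (hdisj : ∀ s ∈ Set.Ioo 0 δ, ∀ s' ∈ Set.Ioo 0 δ, ∀ t t' : ℝ, 0 < t → 0 < t' →
      x s + t • d s = x s' + t' • d s' → s = s') :
    ∃ s ∈ Set.Ioo 0 δ, AvoidsVertices P ν (x s) (d s) := by
  by_contra! hno
  have hno' : ∀ s, ∃ t : ℝ, s ∈ Set.Ioo 0 δ → 0 < t ∧ x s + t • d s ∈ unfoldedVertices P ν := by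
    intro s
    by_cases hs : s ∈ Set.Ioo 0 δ
    · have := hno s hs
      simp only [AvoidsVertices, not_forall, not_not] at this
      obtain ⟨t, ht, hmem⟩ := this
      exact ⟨t, fun _ => ⟨ht, hmem⟩⟩
    · exact ⟨0, fun h => absurd h hs⟩
  choose t ht using hno'
  -- Sending each parameter to an unfolded vertex on its ray is injective because the rays are
  -- disjoint, but an interval is uncountable.
  have hcount : (Set.Ioo 0 δ).Countable := by
    refine Set.MapsTo.countable_of_injOn (f := fun s => x s + t s • d s)
      (fun s hs => (ht s hs).2) ?_ (countable_unfoldedVertices P ν)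
    intro s hs s' hs' h
    exact hdisj s hs s' hs' _ _ (ht s hs).1 (ht s' hs').1 h
  have := hcount.measure_zero MeasureTheory.volume
  rw [Real.volume_Ioo, ENNReal.ofReal_eq_zero] at this
  linarith

theorem exists_pointsInward_vertex (hP : IsStrictlyConvex P) (hν : IsInwardNormal P ν)
    (k : Fin n) :
    ∃ u, ‖u‖ = 1 ∧ PointsInward P ν (P k) u ∧ AvoidsVertices P ν (P k) u := by
  obtain ⟨o, ho⟩ := hP.exists_height_pos hν
  have : Nonempty (Fin n) := ⟨k⟩
  obtain ⟨i₀, hi₀⟩ := Finite.exists_min fun i => height P ν i o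
  set w := o - P k with hw
  have hw0 : w ≠ 0 := by
    intro h
    have := ho k
    rw [sub_eq_zero.1 h, hν.height_vertex_eq_zero_iff.2 (Or.inl rfl)] at this
    exact lt_irrefl _ this
  obtain ⟨μ, hμ, hμw⟩ := exists_unit_normal hw0
  have hpos : ∀ s ∈ Set.Ioo 0 (height P ν i₀ o), ∀ i, 0 < height P ν i (o + s • μ) := by
    intro s hs i
    rw [height_add_smul]
    have h1 := abs_real_inner_le_norm (ν i) μ
    rw [hν.norm_eq, hμ, one_mul] at h1
    have h2 := (abs_le.1 h1).1
    have h3 := hi₀ i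
    have h4 := hs.1
    have h5 := hs.2
    nlinarith
  have hz0 : ∀ s : ℝ, w + s • μ ≠ 0 := by
    intro s h
    have h1 := congrArg (inner ℝ w) h
    rw [inner_add_right, inner_smul_right, real_inner_comm, real_inner_comm μ w, hμw, mul_zero,
      add_zero, inner_zero_right, inner_self_eq_zero] at h1
    exact hw0 h1
  -- The directions aim at points `o + s • μ` on a line through `o` that misses the vertex, so
  -- distinct `s` give disjoint rays. Keeping `s` below the smallest height of `o` keeps these
  -- targets inside the table.
  obtain ⟨s, hs, ha⟩ := exists_avoidsVertices P ν (ho i₀) (fun _ => P k)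
    (fun s => ‖w + s • μ‖⁻¹ • (w + s • μ)) (by
      intro s _ s' _ t t' ht ht' h
      rw [add_right_inj, smul_smul, smul_smul] at h
      set a := t * ‖w + s • μ‖⁻¹
      set b := t' * ‖w + s' • μ‖⁻¹
      have ha : 0 < a := mul_pos ht (inv_pos.2 (norm_pos_iff.2 (hz0 s)))
      have hww : inner ℝ w w ≠ 0 := fun h => hw0 (inner_self_eq_zero.1 h)
      have hwμ : inner ℝ w μ = 0 := by rw [real_inner_comm, hμw]
      have h1 := congrArg (inner ℝ w) h
      have h2 := congrArg (inner ℝ μ) h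
      simp only [inner_add_right, inner_smul_right, hwμ, hμw, mul_zero, add_zero, zero_add,
        real_inner_self_eq_norm_sq μ, hμ, one_pow, mul_one] at h1 h2
      have hab : a = b := mul_right_cancel₀ hww h1
      rw [← hab] at h2
      exact mul_left_cancel₀ ha.ne' h2)
  refine ⟨_, ?_, fun i => ?_, ha⟩
  · rw [norm_smul, norm_inv, norm_norm, inv_mul_cancel₀ (norm_ne_zero_iff.2 (hz0 s))]
  · rcases (hν.height_vertex_nonneg i k).lt_or_eq with h | h
    · exact Or.inl h
    · refine Or.inr ⟨h.symm, ?_⟩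
      rw [inner_smul_right]
      refine mul_pos (inv_pos.2 (norm_pos_iff.2 (hz0 s))) ?_
      have h1 := hpos s hs i
      have h2 : o + s • μ = P k + (w + s • μ) := by rw [hw]; abel
      rwa [h2, height_add, ← h, zero_add] at h1

/-- The bounce sequence of a nonsingular trajectory from a vertex is not periodic. -/
theorem IsBilliardPath.not_isPeriodicSeq (hP : IsStrictlyConvex P) (hν : IsInwardNormal P ν)
    {e : ℕ → Fin n} {x d : ℕ → Plane} (h : IsBilliardPath P e x d) (hd : ‖d 0‖ = 1) {k : Fin n}
    (hk : x 0 = P k) (hin : PointsInward P ν (x 0) (d 0)) : ¬ IsPeriodicSeq e := by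
  rintro ⟨m, hm0, hm⟩
  have hweak := h.isWeakTrajectory hP hν hd
  have hx := hweak.position_periodic hP hν hm (h.outgoing_pos hP hν 0).ne'
  have hd2 : d (2 * m + 1) = d 1 := by
    have h1 := hweak.velocity_periodic hP hν hm
    have h2 := h1 0
    have h3 := h1 (0 + m)
    rw [h2] at h3
    simp only [zero_add] at h3
    rw [two_mul]
    exact h3
  have he : e (2 * m) = e 0 := by
    have h1 := hm 0
    rw [two_mul, hm, ← hm 0, zero_add]
  have hd0 : d (2 * m) = d 0 := by
    rw [← mirror_mirror (hν.norm_eq (e (2 * m))) (d (2 * m)), ← h.bounce hP hν, hd2, he,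
      h.bounce hP hν 0, mirror_mirror (hν.norm_eq _)]
  obtain ⟨j, hj⟩ : ∃ j, 2 * m = j + 1 := ⟨2 * m - 1, by omega⟩
  obtain ⟨t, -, ht⟩ := (h 0).1
  obtain ⟨s, -, hs⟩ := (h (2 * m)).1
  have hx' : x (2 * m + 1) = x (0 + 1) := hx
  rw [hx', hd0, ht] at hs
  have hedge := (h j).2.2.1
  have hout := h.outgoing_pos hP hν j
  rw [← hj] at hedge hout
  rw [hd0] at hout
  have h0 : height P ν k (x 0) = 0 := by rw [hk, hν.height_vertex_eq_zero_iff.2 (Or.inl rfl)]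
  -- Periodicity gives two inward segments in the direction `d 0` ending at the same bounce point.
  -- They start on the boundary, so by convexity at the same point, which would be both a vertex and
  -- inside an edge.
  have heq : x 0 = x (2 * m) := by
    refine eq_of_cross_eq_zero hP hν hd (hin.mem_table hP hν) (mem_table_of_mem_openEdge hedge) h0
      (height_eq_zero_of_mem_openEdge hP hν hedge)
      ((hin k).elim (fun h => absurd h0 h.ne') fun h => h.2) hout ?_
    have : x (2 * m) - x 0 = (t - s) • d 0 := by
      linear_combination (norm := module) -hs
    rw [this, cross_smul, cross_self, mul_zero]
  rw [← heq, hk] at hedge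
  exact vertex_notMem_openEdge hP hν _ _ hedge

/-- The next bounce point depends continuously on the starting point. -/
theorem exists_forall_next_bounce_near (hP : IsStrictlyConvex P) (hν : IsInwardNormal P ν)
    {p d : Plane} {t : ℝ} (ht : 0 < t) {i : Fin n} (hedge : p + t • d ∈ openEdge P i)
    (hd : inner ℝ (ν i) d < 0) {ε : ℝ} (hε : 0 < ε) :
    ∃ η > 0, ∀ q ∈ table P, ‖q - p‖ < η → ∀ (s : ℝ) (j : Fin n), 0 < s →
      q + s • d ∈ openEdge P j → j = i ∧ ‖(q + s • d) - (p + t • d)‖ < ε := by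
  let τ : Plane → ℝ := fun q => -height P ν i q / inner ℝ (ν i) d
  have hτc : Continuous τ := ((continuous_height i).neg).div_const _
  have hτh : ∀ q, height P ν i q + τ q * inner ℝ (ν i) d = 0 := by
    intro q
    simp only [τ]
    rw [div_mul_cancel₀ _ hd.ne]
    ring
  have hτp : τ p = t := by
    have h1 := hτh p
    have h2 := height_eq_zero_of_mem_openEdge hP hν hedge
    rw [height_add_smul] at h2
    exact mul_right_cancel₀ hd.ne (by linarith)
  have hzc : Continuous fun q => q + τ q • d := continuous_id.add (hτc.smul continuous_const)
  have h1 : ∀ᶠ q in nhds p, 0 < τ q :=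
    hτc.continuousAt.eventually (lt_mem_nhds (by rw [hτp]; exact ht))
  have h2 : ∀ᶠ q in nhds p, ∀ j, j ≠ i → 0 < height P ν j (q + τ q • d) := by
    rw [Filter.eventually_all]
    intro j
    by_cases hj : j = i
    · simp [hj]
    · have hc : Continuous fun q => height P ν j (q + τ q • d) := (continuous_height j).comp hzc
      have hjp : 0 < height P ν j (p + τ p • d) := by
        rw [hτp]
        exact height_pos_of_mem_openEdge hP hν hj hedge
      exact (hc.continuousAt.eventually (lt_mem_nhds hjp)).mono fun q hq _ => hq
  have h3 : ∀ᶠ q in nhds p, ‖(q + τ q • d) - (p + t • d)‖ < ε := by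
    have hc : Continuous fun q => ‖(q + τ q • d) - (p + t • d)‖ :=
      (hzc.sub continuous_const).norm
    have hp : ‖(p + τ p • d) - (p + t • d)‖ < ε := by rwa [hτp, sub_self, norm_zero]
    exact hc.continuousAt.eventually (gt_mem_nhds hp)
  obtain ⟨η, hη, hball⟩ := Metric.eventually_nhds_iff.1 ((h1.and h2).and h3)
  refine ⟨η, hη, fun q hq hqp s j hs hj => ?_⟩
  obtain ⟨⟨h4, h5⟩, h6⟩ := hball (by rwa [dist_eq_norm])
  have hqτ := hτh q
  have hji : j = i := by
    by_contra hne
    have h7 := height_pos_of_mem_openEdge hP hν (Ne.symm hne) hj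
    have h8 := height_eq_zero_of_mem_openEdge hP hν hj
    have h9 := h5 j hne
    have h10 := (mem_table_iff hP hν).1 hq j
    rw [height_add_smul] at h7 h8 h9
    -- A bounce on `j ≠ i` would have to come before time `τ q`. But the height over `j` is affine
    -- in time, nonnegative at the start and positive at `τ q`, so it cannot vanish in between.
    have h11 : s < τ q := by
      by_contra! hle
      nlinarith
    nlinarith
  subst hji
  have h8 := height_eq_zero_of_mem_openEdge hP hν hj
  rw [height_add_smul] at h8
  have hsτ : s = τ q := mul_right_cancel₀ hd.ne (by linarith)
  rw [hsτ]
  exact ⟨rfl, h6⟩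

theorem IsBilliardPath.mem_table {e : ℕ → Fin n} {x d : ℕ → Plane} (h : IsBilliardPath P e x d)
    (h0 : x 0 ∈ table P) (k : ℕ) : x k ∈ table P := by
  cases k with
  | zero => exact h0
  | succ k => exact mem_table_of_mem_openEdge (h k).2.2.1

/-- Nearby parallel trajectories have the same bounce sequence for a long time. -/
theorem IsBilliardPath.exists_forall_near (hP : IsStrictlyConvex P) (hν : IsInwardNormal P ν)
    {e : ℕ → Fin n} {x d : ℕ → Plane} (h : IsBilliardPath P e x d) (N : ℕ) :
    ∀ ε > 0, ∃ η > 0, ∀ e' x' d', IsBilliardPath P e' x' d' → x' 0 ∈ table P → d' 0 = d 0 →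
      ‖x' 0 - x 0‖ < η → (∀ k < N, e' k = e k) ∧ ‖x' N - x N‖ < ε ∧ d' N = d N := by
  induction N with
  | zero =>
    intro ε hε
    exact ⟨ε, hε, fun e' x' d' _ _ hd hx => ⟨fun k hk => absurd hk (Nat.not_lt_zero k), hx, hd⟩⟩
  | succ N ih =>
    intro ε hε
    obtain ⟨⟨t, ht, hx⟩, -, hedge, -⟩ := h N
    have hedge' := hedge
    rw [hx] at hedge'
    obtain ⟨ε', hε', hnext⟩ :=
      exists_forall_next_bounce_near hP hν ht hedge' (h.incoming_neg hP hν N) hε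
    obtain ⟨η, hη, hih⟩ := ih ε' hε'
    refine ⟨η, hη, fun e' x' d' h' hx0 hd0 hclose => ?_⟩
    obtain ⟨h1, h2, h3⟩ := hih e' x' d' h' hx0 hd0 hclose
    obtain ⟨⟨s, hs, hx'⟩, -, hedge₂, -⟩ := h' N
    rw [hx', h3] at hedge₂
    obtain ⟨h4, h5⟩ := hnext (x' N) (h'.mem_table hx0 N) h2 s (e' N) hs hedge₂
    refine ⟨fun k hk => ?_, ?_, ?_⟩
    · rcases Nat.lt_succ_iff_lt_or_eq.1 hk with hlt | rfl
      · exact h1 k hlt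
      · exact h4
    · rw [hx', hx, h3]
      exact h5
    · rw [h'.bounce hP hν, h.bounce hP hν, h3, h4]

/-- A trajectory that starts on an edge extends backwards by a bounce on that edge. -/
theorem IsBilliardPath.prepend_mem (hP : IsStrictlyConvex P) (hν : IsInwardNormal P ν)
    {e : ℕ → Fin n} {x d : ℕ → Plane} (h : IsBilliardPath P e x d) (hd : ‖d 0‖ = 1) {A : Fin n}
    (hA : x 0 ∈ openEdge P A) (hdA : 0 < inner ℝ (ν A) (d 0)) :
    prepend A e ∈ forwardBounceSpectrum P := by
  set u := mirror (ν A) (d 0) with hu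
  have hun : ‖u‖ = 1 := by rw [hu, norm_mirror (hν.norm_eq _), hd]
  have : Nonempty (Fin n) := ⟨A⟩
  -- The height over `A` vanishes at `x 0`, so it is replaced by the dummy value `1` in the minimum.
  -- Stepping back by less than `δ` then stays inside the table: no other edge is reached, and the
  -- height over `A` increases.
  obtain ⟨i₀, hi₀⟩ := Finite.exists_min fun i => if i = A then 1 else height P ν i (x 0)
  set δ := if i₀ = A then 1 else height P ν i₀ (x 0) with hδ
  have hδ0 : 0 < δ := by
    rw [hδ]
    split_ifs with h
    · exact one_pos
    · exact height_pos_of_mem_openEdge hP hν h hA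
  have hpos : ∀ r, 0 < r → r < δ → ∀ i, 0 < height P ν i (x 0 + (-r) • u) := by
    intro r hr hrδ i
    rw [height_add_smul]
    by_cases hi : i = A
    · subst hi
      rw [height_eq_zero_of_mem_openEdge hP hν hA, hu, inner_mirror (hν.norm_eq _)]
      have := mul_pos hr hdA
      linarith
    · have h1 := hi₀ i
      rw [if_neg hi] at h1
      have h2 := (abs_le.1 (abs_real_inner_le_norm (ν i) u)).2
      rw [hν.norm_eq, hun, one_mul] at h2
      have h3 : δ ≤ height P ν i (x 0) := h1
      nlinarith
  have hp : x 0 = x 0 + (-(δ / 2)) • u + (δ / 2) • u := by module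
  refine ⟨x 0 + (-(δ / 2)) • u, interior_subset ((mem_interior_table_iff hP hν).2
    (hpos _ (by linarith) (by linarith))), u, hun,
    fun k => Nat.casesOn k (x 0 + (-(δ / 2)) • u) x, fun k => Nat.casesOn k u d, rfl, rfl, ?_⟩
  rintro (_ | k)
  · refine ⟨⟨δ / 2, by linarith, hp⟩, ?_, hA, ?_⟩
    · rintro _ ⟨a, b, ha, hb, hab, rfl⟩
      rw [mem_interior_table_iff hP hν]
      have h1 : a • (x 0 + (-(δ / 2)) • u) + b • x 0 = x 0 + (-(a * (δ / 2))) • u := by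
        rw [show a • (x 0 + (-(δ / 2)) • u) + b • x 0 =
          (a + b) • x 0 + (-(a * (δ / 2))) • u by module, hab, one_smul]
      change ∀ i, 0 < height P ν i (a • (x 0 + (-(δ / 2)) • u) + b • x 0)
      rw [h1]
      exact hpos _ (by positivity) (by nlinarith)
    · change d 0 = reflect P A u
      rw [reflect_eq_mirror hP hν, hu, mirror_mirror (hν.norm_eq _)]
  · exact h k

/-- The edges at a vertex are prefixes for the trajectories from this vertex. -/
theorem IsBilliardPath.isPrefix (hP : IsStrictlyConvex P) (hν : IsInwardNormal P ν)
    {e : ℕ → Fin n} {x d : ℕ → Plane} (h : IsBilliardPath P e x d) (hd : ‖d 0‖ = 1) {k A : Fin n}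
    (hk : x 0 = P k) (hin : PointsInward P ν (x 0) (d 0)) (hA : height P ν A (x 0) = 0) :
    IsPrefix P A e := by
  have hdA : 0 < inner ℝ (ν A) (d 0) := (hin A).elim (fun h => absurd hA h.ne') fun h => h.2
  obtain ⟨w, hw⟩ : ∃ w, w ∈ openEdge P A :=
    ⟨_, 1 / 2, 1 / 2, by norm_num, by norm_num, by norm_num, rfl⟩
  have hwA := height_eq_zero_of_mem_openEdge hP hν hw
  have hwv : w - x 0 ≠ 0 := by
    intro h0
    rw [sub_eq_zero.1 h0, hk] at hw
    exact vertex_notMem_openEdge hP hν _ _ hw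
  have hwνA : inner ℝ (ν A) (w - x 0) = 0 := by rw [← height_sub (P := P), hwA, hA, sub_zero]
  have hedge : ∀ s : ℝ, 0 < s → s < 1 → x 0 + s • (w - x 0) ∈ openEdge P A := by
    intro s hs hs1
    have hpos : ∀ j, j ≠ A → 0 < height P ν j (x 0 + s • (w - x 0)) := by
      intro j hj
      rw [show x 0 + s • (w - x 0) = (1 - s) • x 0 + s • w by module,
        height_convex _ _ _ (by ring)]
      have h1 := mul_pos hs (height_pos_of_mem_openEdge hP hν hj hw)
      have h2 := mul_nonneg (by linarith : 0 ≤ 1 - s)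
        ((mem_table_iff hP hν).1 (hin.mem_table hP hν) j)
      linarith
    have hzero : height P ν A (x 0 + s • (w - x 0)) = 0 := by
      rw [height_add_smul, hA, hwνA, mul_zero, zero_add]
    refine mem_openEdge_of_height_eq_zero hP hν ((mem_table_iff hP hν).2 fun j => ?_) hzero ?_
    · by_cases hj : j = A
      · rw [hj, hzero]
      · exact (hpos j hj).le
    · intro j hj
      obtain ⟨a, ha, h0⟩ := exists_ne_height_vertex_eq_zero hP hν A j
      rw [← hj] at h0
      exact (hpos a ha).ne' h0
  -- Start from a point of `A` near the vertex, parallel to the given trajectory and avoiding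
  -- unfolded vertices. The bound `1` keeps it in the open edge, and `η / ‖w - x 0‖` makes it close
  -- enough to share `N` bounces.
  have hall : ∀ N, ∃ g ∈ forwardBounceSpectrum P, ∀ j < N, g j = prepend A e j := by
    intro N
    obtain ⟨η, hη, hnear⟩ := h.exists_forall_near hP hν N 1 one_pos
    have hwn : 0 < ‖w - x 0‖ := norm_pos_iff.2 hwv
    have hδ : 0 < min 1 (η / ‖w - x 0‖) := lt_min one_pos (div_pos hη hwn)
    obtain ⟨s, ⟨hs0, hs⟩, ha⟩ := exists_avoidsVertices P ν hδ (fun s => x 0 + s • (w - x 0))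
      (fun _ => d 0) (by
        intro s _ s' _ t t' _ _ heq
        have h1 := congrArg (height P ν A) heq
        simp only [height_add_smul, hwνA, mul_zero, add_zero, hA, zero_add] at h1
        rw [mul_right_cancel₀ hdA.ne' h1, add_left_inj, add_right_inj] at heq
        exact smul_left_injective ℝ hwv heq)
    rw [lt_min_iff, lt_div_iff₀ hwn] at hs
    have hsA := hedge s hs0 hs.1
    have hinw : PointsInward P ν (x 0 + s • (w - x 0)) (d 0) := by
      intro j
      by_cases hj : j = A
      · subst hj
        exact Or.inr ⟨height_eq_zero_of_mem_openEdge hP hν hsA, hdA⟩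
      · exact Or.inl (height_pos_of_mem_openEdge hP hν hj hsA)
    obtain ⟨e', x', d', hx', hd', h'⟩ := hinw.exists_isBilliardPath hP hν hd ha
    have hagree := (hnear e' x' d' h' (by rw [hx']; exact hinw.mem_table hP hν) hd' (by
      rw [hx', add_sub_cancel_left, norm_smul, Real.norm_eq_abs, abs_of_pos hs0]
      exact hs.2)).1
    refine ⟨prepend A e', h'.prepend_mem hP hν (by rw [hd', hd]) (by rw [hx']; exact hsA)
      (by rw [hd']; exact hdA), ?_⟩
    rintro (_ | j) hj
    · rfl
    · exact hagree j (by omega)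
  choose g hg hgj using hall
  refine mem_closure_of_tendsto (f := g) (b := Filter.atTop) ?_ (Filter.Eventually.of_forall hg)
  rw [tendsto_pi_nhds]
  intro j
  refine tendsto_const_nhds.congr' ?_
  filter_upwards [Filter.eventually_gt_atTop j] with N hN
  exact (hgj N j hN).symm

theorem isRealizableSetOfCommonPrefixes_of_adjacent (hP : IsStrictlyConvex P) {A B : Fin n}
    (h : Adjacent P A B) : IsRealizableSetOfCommonPrefixes P {A, B} := by
  obtain ⟨ν, hν⟩ := hP.exists_isInwardNormal
  obtain ⟨-, k, hkA, hkB⟩ := h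
  rw [Polygon.edgeSet, affineSegment_eq_segment] at hkA hkB
  obtain ⟨u, hu, hin, ha⟩ := exists_pointsInward_vertex hP hν k
  obtain ⟨e, x, d, hx, rfl, hpath⟩ := hin.exists_isBilliardPath hP hν hu ha
  rw [← hx] at hin
  refine ⟨e, ⟨x 0, hin.mem_table hP hν, d 0, hu, x, d, rfl, rfl, hpath⟩,
    hpath.not_isPeriodicSeq hP hν hu hx hin, ?_⟩
  rintro C (rfl | rfl)
  · exact hpath.isPrefix hP hν hu hx hin (by rw [hx]; exact ((mem_edge_iff hP hν).1 hkA).2)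
  · exact hpath.isPrefix hP hν hu hx hin (by rw [hx]; exact ((mem_edge_iff hP hν).1 hkB).2)

end Vertex

end BilliardTable

theorem mainTheorem9 {n : ℕ} (P : Polygon Plane n) (hP : BilliardTable.IsStrictlyConvex P)
    (A B : Fin n) (hAB : A ≠ B) :
    BilliardTable.Adjacent P A B ↔
      BilliardTable.IsRealizableSetOfCommonPrefixes P {A, B} :=
  ⟨BilliardTable.isRealizableSetOfCommonPrefixes_of_adjacent hP,
    BilliardTable.adjacent_of_isRealizableSetOfCommonPrefixes hP hAB⟩
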